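/- **Conventions.** A signature $\Sigma$ is a set of function symbols and a set of predicate symbols, each with an arity in $\mathbb{N}$, besides equality, which is always available; signatures are countable, their symbols being numbered by natural numbers so that formulas can be given to algorithms. A $\Sigma$-theory $\mathcal{T}$ is given by a (finite or infinite) set $\mathrm{Ax}(\mathcal{T})$ of $\Sigma$-sentences. A $\mathcal{T}$-interpretation is a $\Sigma$-structure with non-empty domain in which all sentences of $\mathrm{Ax}(\mathcal{T})$ hold, together with an assignment of elements of the domain to the variables; a formula is $\mathcal{T}$-satisfiable if some $\mathcal{T}$-interpretation satisfies it. $\mathcal{T}$ is *decidable* if it is decidable whether a given quantifier-free $\Sigma$-formula is $\mathcal{T}$-satisfiable. For a quantifier-free formula $\varphi$, the *spectrum* $\mathrm{Spec}(\mathcal{T},\varphi)$ is the set of countable (finite or $\aleph_0$) cardinalities of the domains of $\mathcal{T}$-interpretations that satisfy $\varphi$. Write $\mathbb{N}^*=\{1,2,3,\dots\}$. * $\mathcal{T}$ is *gentle* if there is an algorithm that, for every conjunction $\varphi$ of literals, outputs a pair $(b,S)$ of a boolean $b$ and a finite set $S\subset\mathbb{N}^*$ such that $\mathrm{Spec}(\mathcal{T},\varphi)=S$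 if $b$ is true and $\mathrm{Spec}(\mathcal{T},\varphi)=(\mathbb{N}^*\cup\{\aleph_0\})\setminus S$ if $b$ is false. * $\mathcal{T}$ has *computable finite spectra* if there is an algorithm that, given a quantifier-free formula $\varphi$ and $k\in\mathbb{N}^*$, decides whether $k\in\mathrm{Spec}(\mathcal{T},\varphi)$. If $\Sigma_1$ and $\Sigma_2$ are disjoint (they share only equality), and $\mathcal{T}_1$, $\mathcal{T}_2$ are a $\Sigma_1$-theory and a $\Sigma_2$-theory, then $\mathcal{T}_1\oplus\mathcal{T}_2$ is the $(\Sigma_1\cup\Sigma_2)$-theory axiomatized by $\mathrm{Ax}(\mathcal{T}_1)\cup\mathrm{Ax}(\mathcal{T}_2)$. **Theorem.** Let $\mathcal{T}_1$ and $\mathcal{T}_2$ be theories over disjoint signatures $\Sigma_1$ and $\Sigma_2$. 1. If $\mathcal{T}_1$ is gentle, and $\mathcal{T}_2$ is decidable and has computable finite spectra, then $\mathcal{T}_1\oplus\mathcal{T}_2$ is decidable. 2. This strengthens Fontaine's gentle combination theorem: $\mathcal{T}_2$ has computable finite spectra as soon as it satisfies any one of the three conditions of that theorem, namely (i) $\mathcal{T}_2$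 is gentle; (ii) $\mathcal{T}_2$ is finitely axiomatizable (some finite set of sentences has the same models as $\mathrm{Ax}(\mathcal{T}_2)$); (iii) there is an algorithm that, for every conjunction $\varphi$ of $\Sigma_2$-literals, outputs a finite set $S\subset\mathbb{N}\cup\{\aleph_0\}$ with $\mathrm{Spec}(\mathcal{T}_2,\varphi)=S$. -/

import Mathlib

namespace TheoryCombination

open FirstOrder FirstOrder.Language
open scoped Cardinal

/-! ### Syntax: literals, conjunctions of literals, Gödel codes -/

/-- A literal: an atomic formula (an equation or a predicate applied to terms) or its negation. -/
def IsLiteral {L : FirstOrder.Language.{0, 0}} (φ : L.Formula ℕ) : Prop :=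
  BoundedFormula.IsAtomic φ ∨ ∃ ψ : L.Formula ℕ, BoundedFormula.IsAtomic ψ ∧ φ = Formula.not ψ

/-- A cube: a conjunction of literals. -/
inductive IsCube {L : FirstOrder.Language.{0, 0}} : L.Formula ℕ → Prop
  | literal {φ : L.Formula ℕ} : IsLiteral φ → IsCube φ
  | conj {φ ψ : L.Formula ℕ} : IsCube φ → IsCube ψ → IsCube (φ ⊓ ψ)

/-- The Gödel code of a term, the symbols of the signature being numbered by `Encodable.encode`.
The free variables are `Sum.inl i`, the variables reserved for quantifiers are `Sum.inr i`.
The list of the codes of the arguments (hence the arity) can be read off from the code. -/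
def termCode {L : FirstOrder.Language.{0, 0}} [Encodable (Σ n, L.Functions n)] {m : ℕ} :
    L.Term (ℕ ⊕ Fin m) → ℕ
  | .var (Sum.inl i) => Nat.pair 0 i
  | .var (Sum.inr i) => Nat.pair 1 i
  | .func (l := l) f ts =>
      Nat.pair 2 (Nat.pair (Encodable.encode (⟨l, f⟩ : Σ n, L.Functions n))
        (Encodable.encode (List.ofFn fun i => termCode (ts i))))

/-- The Gödel code of a first-order formula. -/
def code {L : FirstOrder.Language.{0, 0}} [Encodable (Σ n, L.Functions n)] [Encodable (Σ n, L.Relations n)] :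
    {m : ℕ} → L.BoundedFormula ℕ m → ℕ
  | _, .falsum => Nat.pair 0 0
  | _, .equal s t => Nat.pair 1 (Nat.pair (termCode s) (termCode t))
  | _, .rel (l := l) R ts =>
      Nat.pair 2 (Nat.pair (Encodable.encode (⟨l, R⟩ : Σ n, L.Relations n))
        (Encodable.encode (List.ofFn fun i => termCode (ts i))))
  | _, .imp φ ψ => Nat.pair 3 (Nat.pair (code φ) (code ψ))
  | _, .all φ => Nat.pair 4 (code φ)

/-! ### Semantics: satisfiability and spectra -/

/-- `φ` is `T`-satisfiable: some `T`-interpretation, that is, a model of the axioms `T` together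
with an assignment of values to the variables, satisfies `φ`. (The signatures are countable, so
by Löwenheim–Skolem it does not matter in which universe the domains are taken. The domain is
non-empty, since the variables have values in it.) -/
def Satisfiable {L : FirstOrder.Language.{0, 0}} (T : L.Theory) (φ : L.Formula ℕ) : Prop :=
  ∃ (M : Type) (_ : L.Structure M) (v : ℕ → M), M ⊨ T ∧ φ.Realize v

/-- `Spec(T, φ)`: the countable (finite or `ℵ₀`) cardinalities of the `T`-interpretations that
satisfy `φ`. -/
def Spec {L : FirstOrder.Language.{0, 0}} (T : L.Theory) (φ : L.Formula ℕ) : Set Cardinal.{0} :=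
  {κ | κ ≤ ℵ₀ ∧
    ∃ (M : Type) (_ : L.Structure M) (v : ℕ → M), M ⊨ T ∧ φ.Realize v ∧ #M = κ}

/-! ### Computability properties of theories -/

section
variable {L : FirstOrder.Language.{0, 0}} [Encodable (Σ n, L.Functions n)] [Encodable (Σ n, L.Relations n)]

/-- `T` is decidable: an algorithm decides, given a quantifier-free formula `φ`, whether `φ` is
`T`-satisfiable. -/
def IsDecidable (T : L.Theory) : Prop :=
  ∃ f : ℕ → Bool, Computable f ∧
    ∀ φ : L.Formula ℕ, BoundedFormula.IsQF φ → (f (code φ) = true ↔ Satisfiable T φ)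

/-- `T` is gentle: an algorithm outputs, given a conjunction `φ` of literals, a pair of a boolean
`b` and (a list of the elements of) a finite set `S` of positive integers, such that `Spec(T, φ)`
is `S` if `b` is true, and is the complement of `S` in `{1, 2, 3, …} ∪ {ℵ₀}` if `b` is false. -/
def IsGentle (T : L.Theory) : Prop :=
  ∃ f : ℕ → Bool × List ℕ, Computable f ∧
    ∀ φ : L.Formula ℕ, IsCube φ →
      (∀ n ∈ (f (code φ)).2, 0 < n) ∧
      ((f (code φ)).1 = true → Spec T φ = {κ | ∃ n ∈ (f (code φ)).2, κ = (n : Cardinal)}) ∧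
      ((f (code φ)).1 = false → Spec T φ =
        {κ | 0 < κ ∧ κ ≤ ℵ₀ ∧ ¬ ∃ n ∈ (f (code φ)).2, κ = (n : Cardinal)})

/-- `T` has computable finite spectra: an algorithm decides, given a quantifier-free formula `φ`
and a positive integer `k`, whether `k ∈ Spec(T, φ)`. -/
def HasComputableFiniteSpectra (T : L.Theory) : Prop :=
  ∃ f : ℕ → ℕ → Bool, Computable₂ f ∧
    ∀ φ : L.Formula ℕ, BoundedFormula.IsQF φ → ∀ k : ℕ, 0 < k →
      (f (code φ) k = true ↔ (k : Cardinal) ∈ Spec T φ)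

/-- An algorithm outputs, given a conjunction `φ` of literals, (a list of the elements of) a finite
set `S` of natural numbers and possibly `ℵ₀`, the latter represented by `none`, such that
`Spec(T, φ) = S`. -/
def HasComputableSpectraAsFiniteSets (T : L.Theory) : Prop :=
  ∃ f : ℕ → List (Option ℕ), Computable f ∧
    ∀ φ : L.Formula ℕ, IsCube φ →
      Spec T φ = {κ | (∃ n : ℕ, some n ∈ f (code φ) ∧ κ = (n : Cardinal)) ∨
        (none ∈ f (code φ) ∧ κ = ℵ₀)}

end

/-- `T` is finitely axiomatizable: some finite set of sentences has the same models. -/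
def IsFinitelyAxiomatizable {L : FirstOrder.Language.{0, 0}} (T : L.Theory) : Prop :=
  ∃ A : L.Theory, A.Finite ∧
    ∀ (M : Type) [L.Structure M] [Nonempty M], M ⊨ T ↔ M ⊨ A

/-! ### Combination of theories over disjoint signatures -/

/-- The function symbols of the disjoint union of two signatures are numbered by `2 * c` for the
symbol number `c` of the first and by `2 * c + 1` for the symbol number `c` of the second. -/
instance encodableSumFunctions (L₁ L₂ : FirstOrder.Language.{0, 0})
    [Encodable (Σ n, L₁.Functions n)] [Encodable (Σ n, L₂.Functions n)] :
    Encodable (Σ n, (L₁.sum L₂).Functions n) :=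
  Encodable.ofEquiv ((Σ n, L₁.Functions n) ⊕ (Σ n, L₂.Functions n))
    (Equiv.sigmaSumDistrib L₁.Functions L₂.Functions)

/-- The predicate symbols of the disjoint union of two signatures are numbered likewise. -/
instance encodableSumRelations (L₁ L₂ : FirstOrder.Language.{0, 0})
    [Encodable (Σ n, L₁.Relations n)] [Encodable (Σ n, L₂.Relations n)] :
    Encodable (Σ n, (L₁.sum L₂).Relations n) :=
  Encodable.ofEquiv ((Σ n, L₁.Relations n) ⊕ (Σ n, L₂.Relations n))
    (Equiv.sigmaSumDistrib L₁.Relations L₂.Relations)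

/-- `T₁ ⊕ T₂`: the theory over the union of the two disjoint signatures whose axioms are those of
`T₁` together with those of `T₂`. -/
def combine {L₁ L₂ : FirstOrder.Language.{0, 0}} (T₁ : L₁.Theory) (T₂ : L₂.Theory) : (L₁.sum L₂).Theory :=
  (LHom.sumInl : L₁ →ᴸ L₁.sum L₂).onTheory T₁ ∪ (LHom.sumInr : L₂ →ᴸ L₁.sum L₂).onTheory T₂

end TheoryCombination

namespace TheoryCombination

open FirstOrder FirstOrder.Language
open scoped Cardinal

/-! ### Injectivity of the Gödel numbering -/

section Injectivity
variable {L : FirstOrder.Language.{0, 0}} [Encodable (Σ n, L.Functions n)]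

/-! A quantifier-free formula is reduced to finitely many guesses. A guess `A` is a set of
subformulas and of equations between subterms that are declared true. It must respect the
connectives and contain the formula itself. What it asserts about the symbols is its `Diagram`. Each
subterm is replaced by a variable whose number is the code of that subterm, so every fact in the
diagram is a flat literal with at most one symbol, and a formula over a disjoint union of signatures
is purified. The facts split into a cube over each signature, and the two cubes share only the
equalities and disequalities between the variables.

If the two cubes have models of the same cardinality, finite or `ℵ₀`, the finite partial bijection
between the values of the subterms extends to a bijection of the domains. Transporting one structure
along it gives a model of both theories (`satisfiable_combine_of_diagrams`). Conversely, by
Löwenheim–Skolem, a satisfiable formula has a countable model, whose reducts satisfy both cubes of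
some guess. So satisfiability in the combination means that for some consistent guess the two
spectra meet.

Gentleness makes this decidable (`spectraMeet_iff`). If the first spectrum is a finite set, each
member is tested in the second. If it is the complement of a finite set `S`, sizes up to a bound for
`S` are tested one by one. Every larger size, `ℵ₀` included, is in the first spectrum, so it only
remains to ask whether the second spectrum reaches beyond the bound. That is satisfiability of the
second cube with enough pairwise distinct fresh variables added (`satisfiable_cube_iff`), which
decidability of the second theory answers.

In the second statement, gentle theories and theories with computable finite sets as spectra are
handled by the same guesses, which reduce quantifier-free formulas to cubes. For a finitely
axiomatizable theory, only the finitely many symbols of the axioms and of the formula matter, so all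
structures of size `k` can be searched as finite tables. -/

theorem termCode_injective {m : ℕ} :
    Function.Injective (termCode : L.Term (ℕ ⊕ Fin m) → ℕ) := by
  intro s
  induction s with
  | var x =>
    intro t h
    rcases t with (y | _)
    · rcases x with x | x <;> rcases y with y | y <;>
        simp_all [termCode, Nat.pair_eq_pair, Fin.ext_iff]
    · rcases x with x | x <;> simp [termCode, Nat.pair_eq_pair] at h
  | func f ts ih =>
    intro t h
    rcases t with (y | @⟨k, g, us⟩)
    · rcases y with y | y <;> simp [termCode, Nat.pair_eq_pair] at h
    · simp only [termCode, Nat.pair_eq_pair, Encodable.encode_inj, true_and] at h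
      obtain ⟨h₁, h₂⟩ := h
      cases h₁
      have h₃ := List.ofFn_injective h₂
      congr 1
      funext i
      exact ih i (congrFun h₃ i)

variable [Encodable (Σ n, L.Relations n)]

/-- Algorithms see only numbers; injectivity lets a set of codes be read as a set of formulas, and a
subterm code serve as the name of a variable. -/
theorem code_injective {m : ℕ} :
    Function.Injective (code : L.BoundedFormula ℕ m → ℕ) := by
  intro φ
  induction φ with
  | falsum => intro ψ h; cases ψ <;> simp_all [code, Nat.pair_eq_pair]
  | equal s t =>
    intro ψ h
    cases ψ <;> simp_all [code, Nat.pair_eq_pair, termCode_injective.eq_iff]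
  | rel R ts =>
    intro ψ h
    cases ψ with
    | rel S us =>
      simp only [code, Nat.pair_eq_pair, Encodable.encode_inj, true_and] at h
      obtain ⟨h₁, h₂⟩ := h
      cases h₁
      have h₃ := List.ofFn_injective h₂
      congr 1
      funext i
      exact termCode_injective (congrFun h₃ i)
    | _ => simp [code, Nat.pair_eq_pair] at h
  | imp φ₁ φ₂ ih₁ ih₂ =>
    intro ψ h
    cases ψ with
    | imp ψ₁ ψ₂ =>
      simp only [code, Nat.pair_eq_pair, true_and] at h
      rw [ih₁ h.1, ih₂ h.2]
    | _ => simp [code, Nat.pair_eq_pair] at h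
  | all φ ih =>
    intro ψ h
    cases ψ with
    | all ψ =>
      simp only [code, Nat.pair_eq_pair, true_and] at h
      rw [ih h]
    | _ => simp [code, Nat.pair_eq_pair] at h

end Injectivity

/-! ### Subterms and subformulas of a code -/

/-- The constructor recorded in a code. -/
def tag (m : ℕ) : ℕ := m.unpair.1

/-- The first component of the data recorded in a code. -/
def lhs (m : ℕ) : ℕ := m.unpair.2.unpair.1

/-- The second component of the data recorded in a code. -/
def rhs (m : ℕ) : ℕ := m.unpair.2.unpair.2

/-- The list of argument codes recorded in the code of an application of a symbol. -/
def args (m : ℕ) : List ℕ := Denumerable.ofNat (List ℕ) (rhs m)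

@[simp] theorem tag_pair (a b : ℕ) : tag (Nat.pair a b) = a := by simp [tag]
@[simp] theorem lhs_pair (a b c : ℕ) : lhs (Nat.pair a (Nat.pair b c)) = b := by simp [lhs]
@[simp] theorem rhs_pair (a b c : ℕ) : rhs (Nat.pair a (Nat.pair b c)) = c := by simp [rhs]
@[simp] theorem args_pair (a b : ℕ) (l : List ℕ) :
    args (Nat.pair a (Nat.pair b (Encodable.encode l))) = l := by
  simp [args]

theorem data_lt {m : ℕ} (h : tag m ≠ 0) : m.unpair.2 < m := by
  have h₁ : Nat.pair m.unpair.1 m.unpair.2 = m := Nat.pair_unpair m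
  have h₂ : 0 < m.unpair.1 := Nat.pos_of_ne_zero h
  generalize m.unpair.1 = a at *
  generalize m.unpair.2 = b at *
  subst h₁
  unfold Nat.pair
  split_ifs <;> nlinarith

theorem lhs_lt {m : ℕ} (h : tag m ≠ 0) : lhs m < m :=
  (Nat.unpair_left_le _).trans_lt (data_lt h)

theorem rhs_lt {m : ℕ} (h : tag m ≠ 0) : rhs m < m :=
  (Nat.unpair_right_le _).trans_lt (data_lt h)

theorem lt_encode_of_mem {a : ℕ} {l : List ℕ} (h : a ∈ l) : a < Encodable.encode l := by
  induction l with
  | nil => simp at h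
  | cons b l ih =>
    rw [Encodable.encode_list_cons, Nat.lt_succ_iff]
    rcases List.mem_cons.1 h with rfl | h
    · exact Nat.left_le_pair _ _
    · exact (ih h).le.trans (Nat.right_le_pair _ _)

theorem lt_of_mem_args {a m : ℕ} (h : a ∈ args m) : a < m := by
  have h₁ := lt_encode_of_mem h
  rw [args, Denumerable.encode_ofNat] at h₁
  exact h₁.trans_le ((Nat.unpair_right_le _).trans (Nat.unpair_right_le _))

/-- The immediate constituents of a term (marked `false`) or formula (marked `true`), on codes. -/
def constituents (x : Bool × ℕ) : List (Bool × ℕ) :=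
  if tag x.2 = 2 then (args x.2).map (Prod.mk false)
  else if x.1 = true ∧ tag x.2 = 1 then [(false, lhs x.2), (false, rhs x.2)]
  else if x.1 = true ∧ tag x.2 = 3 then [(true, lhs x.2), (true, rhs x.2)]
  else []

theorem snd_lt_of_mem_constituents {x y : Bool × ℕ} (h : y ∈ constituents x) : y.2 < x.2 := by
  unfold constituents at h
  split_ifs at h with h₁ h₂ h₃
  · obtain ⟨a, ha, rfl⟩ := List.mem_map.1 h
    exact lt_of_mem_args ha
  · have : tag x.2 ≠ 0 := by omega
    rcases (by simpa using h : y = _ ∨ y = _) with rfl | rfl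
    exacts [lhs_lt this, rhs_lt this]
  · have : tag x.2 ≠ 0 := by omega
    rcases (by simpa using h : y = _ ∨ y = _) with rfl | rfl
    exacts [lhs_lt this, rhs_lt this]
  · simp at h

/-- The subformulas and subterms down to a given depth of the formula with code `n`. -/
def nodesUpTo (n : ℕ) (j : ℕ) : List (Bool × ℕ) :=
  (fun l => l ++ l.flatMap constituents)^[j] [(true, n)]

theorem mem_nodesUpTo_succ {n j : ℕ} {x : Bool × ℕ} :
    x ∈ nodesUpTo n (j + 1) ↔
      x ∈ nodesUpTo n j ∨ ∃ y ∈ nodesUpTo n j, x ∈ constituents y := by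
  rw [nodesUpTo, Function.iterate_succ_apply', ← nodesUpTo, List.mem_append, List.mem_flatMap]

/-- The subformulas and subterms of the formula with code `n`. -/
def nodes (n : ℕ) : List (Bool × ℕ) := nodesUpTo n (n + 1)

theorem nodes_induction {n : ℕ} {p : Bool × ℕ → Prop} (root : p (true, n))
    (step : ∀ x, p x → ∀ y ∈ constituents x, p y) : ∀ x ∈ nodes n, p x := by
  suffices ∀ j, ∀ x ∈ nodesUpTo n j, p x from this _
  intro j
  induction j with
  | zero => intro x hx; rw [List.mem_singleton.1 hx]; exact root
  | succ j ih =>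
    intro x hx
    rcases mem_nodesUpTo_succ.1 hx with hx | ⟨y, hy, hx⟩
    exacts [ih x hx, step y (ih y hy) x hx]

theorem root_mem_nodes (n : ℕ) : (true, n) ∈ nodes n := by
  suffices ∀ j, (true, n) ∈ nodesUpTo n j from this _
  intro j
  induction j with
  | zero => exact List.mem_singleton_self _
  | succ j ih => exact mem_nodesUpTo_succ.2 (Or.inl ih)

/-- Codes strictly decrease on passing to constituents, so a node that is new in round `j` has code
at most `n - j`. After `n + 1` rounds nothing new can remain. -/
theorem nodes_closed {n : ℕ} {x y : Bool × ℕ} (hx : x ∈ nodes n) (hy : y ∈ constituents x) :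
    y ∈ nodes n := by
  suffices ∀ j, ∀ x ∈ nodesUpTo n j,
      (∀ y ∈ constituents x, y ∈ nodesUpTo n j) ∨ x.2 + j ≤ n by
    rcases this _ x hx with h | h
    exacts [h y hy, by omega]
  intro j
  induction j with
  | zero => intro x hx; rw [List.mem_singleton.1 hx]; exact Or.inr le_rfl
  | succ j ih =>
    intro x hx
    by_cases hx' : x ∈ nodesUpTo n j
    · exact Or.inl fun y hy => mem_nodesUpTo_succ.2 (Or.inr ⟨x, hx', hy⟩)
    · rcases mem_nodesUpTo_succ.1 hx with hx | ⟨z, hz, hx⟩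
      · exact absurd hx hx'
      · rcases ih z hz with h | h
        · exact absurd (h x hx) hx'
        · have := snd_lt_of_mem_constituents hx
          exact Or.inr (by omega)

/-- The codes of the subterms of the formula with code `n`. -/
def termNodes (n : ℕ) : List ℕ := ((nodes n).filter fun x => x.1 = false).map Prod.snd

/-- The codes of the subformulas of the formula with code `n`. -/
def formulaNodes (n : ℕ) : List ℕ := ((nodes n).filter fun x => x.1 = true).map Prod.snd

theorem mem_termNodes {n m : ℕ} : m ∈ termNodes n ↔ (false, m) ∈ nodes n := by
  simp [termNodes]

theorem mem_formulaNodes {n m : ℕ} : m ∈ formulaNodes n ↔ (true, m) ∈ nodes n := by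
  simp [formulaNodes]

section Genuine
variable {L : FirstOrder.Language.{0, 0}} [Encodable (Σ n, L.Functions n)]

theorem mem_termNodes_of_func {n k : ℕ} {f : L.Functions k} {ts : Fin k → L.Term (ℕ ⊕ Fin 0)}
    (h : termCode (Term.func f ts) ∈ termNodes n) (i : Fin k) : termCode (ts i) ∈ termNodes n := by
  rw [mem_termNodes] at h ⊢
  refine nodes_closed h ?_
  simp only [constituents, termCode, tag_pair, if_true, args_pair]
  exact List.mem_map.2 ⟨_, List.mem_ofFn.2 ⟨i, rfl⟩, rfl⟩

variable [Encodable (Σ n, L.Relations n)]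

theorem mem_termNodes_of_rel {n k : ℕ} {R : L.Relations k} {ts : Fin k → L.Term (ℕ ⊕ Fin 0)}
    (h : code (BoundedFormula.rel R ts) ∈ formulaNodes n) (i : Fin k) :
    termCode (ts i) ∈ termNodes n := by
  rw [mem_formulaNodes] at h
  rw [mem_termNodes]
  refine nodes_closed h ?_
  simp only [constituents, code, tag_pair, if_true, args_pair]
  exact List.mem_map.2 ⟨_, List.mem_ofFn.2 ⟨i, rfl⟩, rfl⟩

theorem mem_termNodes_of_equal {n : ℕ} {s t : L.Term (ℕ ⊕ Fin 0)}
    (h : code (BoundedFormula.equal s t) ∈ formulaNodes n) :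
    termCode s ∈ termNodes n ∧ termCode t ∈ termNodes n := by
  rw [mem_formulaNodes] at h
  rw [mem_termNodes, mem_termNodes]
  constructor <;> exact nodes_closed h (by simp [constituents, code])

theorem mem_formulaNodes_of_imp {n : ℕ} {φ ψ : L.Formula ℕ}
    (h : code (BoundedFormula.imp φ ψ) ∈ formulaNodes n) :
    code φ ∈ formulaNodes n ∧ code ψ ∈ formulaNodes n := by
  rw [mem_formulaNodes] at h
  rw [mem_formulaNodes, mem_formulaNodes]
  constructor <;> exact nodes_closed h (by simp [constituents, code])

/-- The decomposition acts on bare numbers; this invariant keeps it inside the codes of actual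
syntax, so that membership in a node list can be turned back into a term or formula. -/
theorem nodes_genuine {φ : L.Formula ℕ} (hφ : BoundedFormula.IsQF φ) :
    ∀ x ∈ nodes (code φ), (x.1 = false → ∃ t : L.Term (ℕ ⊕ Fin 0), termCode t = x.2) ∧
      (x.1 = true → ∃ ψ : L.Formula ℕ, BoundedFormula.IsQF ψ ∧ code ψ = x.2) := by
  refine nodes_induction ⟨by simp, fun _ => ⟨φ, hφ, rfl⟩⟩ ?_
  rintro ⟨b, m⟩ ⟨ht, hf⟩ y hy
  cases b with
  | false =>
    obtain ⟨t, rfl⟩ := ht rfl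
    cases t with
    | var x => rcases x with x | x <;> simp [constituents, termCode] at hy
    | func f ts =>
      simp only [constituents, termCode, tag_pair, if_true, args_pair, List.mem_map,
        List.mem_ofFn] at hy
      obtain ⟨_, ⟨i, rfl⟩, rfl⟩ := hy
      exact ⟨fun _ => ⟨_, rfl⟩, by simp⟩
  | true =>
    obtain ⟨ψ, hψ, rfl⟩ := hf rfl
    cases hψ with
    | falsum => simp [constituents, code] at hy
    | of_isAtomic h =>
      cases h with
      | equal s t =>
        simp only [constituents, Term.bdEqual, code, tag_pair] at hy
        rcases (by simpa using hy : y = _ ∨ y = _) with rfl | rfl <;>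
          exact ⟨fun _ => ⟨_, rfl⟩, by simp⟩
      | rel R ts =>
        simp only [constituents, Relations.boundedFormula, code, tag_pair, if_true, args_pair,
          List.mem_map, List.mem_ofFn] at hy
        obtain ⟨_, ⟨i, rfl⟩, rfl⟩ := hy
        exact ⟨fun _ => ⟨_, rfl⟩, by simp⟩
    | @imp φ₁ φ₂ h₁ h₂ =>
      simp only [constituents, code, tag_pair] at hy
      rcases (by simpa using hy : y = _ ∨ y = _) with rfl | rfl
      exacts [⟨by simp, fun _ => ⟨_, h₁, rfl⟩⟩, ⟨by simp, fun _ => ⟨_, h₂, rfl⟩⟩]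

theorem exists_term_of_mem {φ : L.Formula ℕ} (hφ : BoundedFormula.IsQF φ) {m : ℕ}
    (h : m ∈ termNodes (code φ)) : ∃ t : L.Term (ℕ ⊕ Fin 0), termCode t = m :=
  (nodes_genuine hφ _ (mem_termNodes.1 h)).1 rfl

theorem exists_formula_of_mem {φ : L.Formula ℕ} (hφ : BoundedFormula.IsQF φ) {m : ℕ}
    (h : m ∈ formulaNodes (code φ)) : ∃ ψ : L.Formula ℕ, BoundedFormula.IsQF ψ ∧ code ψ = m :=
  (nodes_genuine hφ _ (mem_formulaNodes.1 h)).2 rfl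

end Genuine

/-! ### Guessing the truth values of the subformulas and the equalities of the subterms -/

/-- The code of the equation between the terms with the given codes. -/
def equalCode (s t : ℕ) : ℕ := Nat.pair 1 (Nat.pair s t)

/-- The codes of the subformulas, and of the equations between subterms. -/
def candidates (n : ℕ) : List ℕ :=
  formulaNodes n ++ (termNodes n).flatMap fun s => (termNodes n).map (equalCode s)

/-- All sets of candidates. -/
def guesses (n : ℕ) : List (List ℕ) := (candidates n).sublists'

/-- The set `A` of the formulas guessed to be true respects the propositional connectives, and
contains the formula with code `n`. -/
def Consistent (n : ℕ) (A : List ℕ) : Prop :=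
  n ∈ A ∧ ∀ m ∈ formulaNodes n, (tag m = 0 → m ∉ A) ∧
    (tag m = 3 → (m ∈ A ↔ (lhs m ∈ A → rhs m ∈ A)))

/-- The facts about the `L'`-symbols that the guess `A` asserts for the formula with code `n`,
where the variable `m` stands for the value of the subterm with code `m`. -/
structure Diagram {L L' : FirstOrder.Language.{0, 0}} [Encodable (Σ n, L.Functions n)]
    [Encodable (Σ n, L.Relations n)] (ι : L' →ᴸ L) (n : ℕ) (A : List ℕ) (M : Type)
    [L'.Structure M] (w : ℕ → M) : Prop where
  equal : ∀ s ∈ termNodes n, ∀ t ∈ termNodes n, (w s = w t ↔ equalCode s t ∈ A)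
  func : ∀ (k : ℕ) (f : L'.Functions k) (ts : Fin k → L.Term (ℕ ⊕ Fin 0)),
    termCode (Term.func (ι.onFunction f) ts) ∈ termNodes n →
      w (termCode (Term.func (ι.onFunction f) ts)) =
        Structure.funMap f fun i => w (termCode (ts i))
  rel : ∀ (k : ℕ) (R : L'.Relations k) (ts : Fin k → L.Term (ℕ ⊕ Fin 0)),
    code (BoundedFormula.rel (ι.onRelation R) ts : L.Formula ℕ) ∈ formulaNodes n →
      ((Structure.RelMap R fun i => w (termCode (ts i))) ↔
        code (BoundedFormula.rel (ι.onRelation R) ts : L.Formula ℕ) ∈ A)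

section
variable {L : FirstOrder.Language.{0, 0}} [Encodable (Σ n, L.Functions n)]
  [Encodable (Σ n, L.Relations n)]

variable (L) in
/-- The number `c` is the code of a formula that holds under the assignment `v`. -/
def HoldsCode {M : Type} [L.Structure M] (v : ℕ → M) (c : ℕ) : Prop :=
  ∃ ψ : L.Formula ℕ, code ψ = c ∧ ψ.Realize v

theorem holdsCode_code {M : Type} [L.Structure M] {v : ℕ → M} (ψ : L.Formula ℕ) :
    HoldsCode L v (code ψ) ↔ ψ.Realize v :=
  ⟨fun ⟨_, h₁, h₂⟩ => code_injective h₁ ▸ h₂, fun h => ⟨ψ, rfl, h⟩⟩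

/-- A model dictates its own guess: the candidates that are true in it. The variable named by a term
code takes the value of that term. -/
theorem exists_diagram_of_realize {φ : L.Formula ℕ} (hφ : BoundedFormula.IsQF φ) {M : Type}
    [L.Structure M] {v : ℕ → M} (h : φ.Realize v) :
    ∃ A ∈ guesses (code φ), Consistent (code φ) A ∧
      ∃ w, Diagram (LHom.id L) (code φ) A M w := by
  classical
  let A := (candidates (code φ)).filter (HoldsCode L v)
  have mem_A {c : ℕ} : c ∈ A ↔ c ∈ candidates (code φ) ∧ HoldsCode L v c := by simp [A]
  have mem_A_of_formula {ψ : L.Formula ℕ} (hψ : code ψ ∈ formulaNodes (code φ)) :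
      code ψ ∈ A ↔ ψ.Realize v := by
    rw [mem_A, holdsCode_code, and_iff_right]
    exact List.mem_append_left _ hψ
  -- Numbers that are not term codes get the irrelevant value `v 0`.
  let w : ℕ → M := fun c =>
    if h : ∃ t : L.Term (ℕ ⊕ Fin 0), termCode t = c then h.choose.realize (Sum.elim v default)
    else v 0
  have w_code (t : L.Term (ℕ ⊕ Fin 0)) : w (termCode t) = t.realize (Sum.elim v default) := by
    have ht : ∃ u : L.Term (ℕ ⊕ Fin 0), termCode u = termCode t := ⟨t, rfl⟩
    simp only [w, dif_pos ht]
    rw [termCode_injective ht.choose_spec]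
  refine ⟨A, List.mem_sublists'.2 List.filter_sublist, ⟨?_, ?_⟩, w, ?_, ?_, ?_⟩
  · exact (mem_A_of_formula (mem_formulaNodes.2 (root_mem_nodes _))).2 h
  · intro m hm
    obtain ⟨ψ, hψ, rfl⟩ := exists_formula_of_mem hφ hm
    rw [mem_A_of_formula hm]
    cases hψ with
    | falsum => simp [code, Formula.Realize, BoundedFormula.Realize]
    | of_isAtomic h =>
      cases h <;> simp [code, Term.bdEqual, Relations.boundedFormula]
    | @imp φ₁ φ₂ h₁ h₂ =>
      obtain ⟨m₁, m₂⟩ := mem_formulaNodes_of_imp hm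
      simp only [code, tag_pair, lhs_pair, rhs_pair, mem_A_of_formula m₁, mem_A_of_formula m₂]
      simp [Formula.Realize]
  · intro s hs t ht
    have : equalCode s t ∈ candidates (code φ) :=
      List.mem_append_right _ (List.mem_flatMap.2 ⟨s, hs, List.mem_map.2 ⟨t, ht, rfl⟩⟩)
    rw [mem_A, and_iff_right this]
    obtain ⟨s, rfl⟩ := exists_term_of_mem hφ hs
    obtain ⟨t, rfl⟩ := exists_term_of_mem hφ ht
    exact (by rw [w_code, w_code]; rfl : _ ↔ Formula.Realize (.equal s t) v).trans
      (holdsCode_code (.equal s t)).symm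
  · intro k f ts _
    simp only [w_code]
    rfl
  · intro k R ts h
    rw [mem_A_of_formula h]
    simp only [w_code]
    rfl

/-- Values of the original variables are read off at their codes. The function clauses propagate
this to all subterms; consistency of the guess then propagates truth from atoms to the whole
formula. -/
theorem realize_of_diagram {φ : L.Formula ℕ} (hφ : BoundedFormula.IsQF φ) {M : Type}
    [L.Structure M] {A : List ℕ} {w : ℕ → M} (hA : Consistent (code φ) A)
    (hw : Diagram (LHom.id L) (code φ) A M w) : ∃ v : ℕ → M, φ.Realize v := by
  let v : ℕ → M := fun i => w (termCode (Term.var (Sum.inl i) : L.Term (ℕ ⊕ Fin 0)))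
  refine ⟨v, ?_⟩
  have w_code (t : L.Term (ℕ ⊕ Fin 0)) (ht : termCode t ∈ termNodes (code φ)) :
      t.realize (Sum.elim v default) = w (termCode t) := by
    induction t with
    | var x =>
      rcases x with x | x
      exacts [rfl, x.elim0]
    | func f ts ih =>
      refine Eq.trans ?_ (hw.func _ f ts ht).symm
      simp only [Term.realize]
      congr 1
      funext i
      exact ih i (mem_termNodes_of_func ht i)
  suffices ∀ ψ : L.Formula ℕ, BoundedFormula.IsQF ψ → code ψ ∈ formulaNodes (code φ) →
      (ψ.Realize v ↔ code ψ ∈ A) from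
    (this φ hφ (mem_formulaNodes.2 (root_mem_nodes _))).2 hA.1
  intro ψ hψ
  induction hψ with
  | falsum =>
    intro h
    have := (hA.2 _ h).1 (by simp [code])
    simp [this, Formula.Realize, BoundedFormula.Realize]
  | of_isAtomic h =>
    intro hm
    cases h with
    | equal s t =>
      obtain ⟨hs, ht⟩ := mem_termNodes_of_equal hm
      refine Iff.trans ?_ (hw.equal _ hs _ ht)
      rw [← w_code s hs, ← w_code t ht]
      rfl
    | rel R ts =>
      refine Iff.trans ?_ (hw.rel _ R ts hm)
      simp only [← w_code _ (mem_termNodes_of_rel hm _)]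
      rfl
  | @imp φ₁ φ₂ h₁ h₂ ih₁ ih₂ =>
    intro hm
    obtain ⟨m₁, m₂⟩ := mem_formulaNodes_of_imp hm
    have := (hA.2 _ hm).2 (by simp [code])
    rw [this]
    simp only [code, lhs_pair, rhs_pair, ← ih₁ m₁, ← ih₂ m₂]
    rfl

end

/-! ### The cube of the facts asserted by a guess -/

/-- The code of the equation between two variables. -/
def varEqualCode (i j : ℕ) : ℕ := equalCode (Nat.pair 0 i) (Nat.pair 0 j)

/-- The code of the negation of the formula with the given code. -/
def notCode (c : ℕ) : ℕ := Nat.pair 3 (Nat.pair c (Nat.pair 0 0))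

/-- The code of an application of the symbol with number `e` to variables. -/
def applyCode (e : ℕ) (l : List ℕ) : ℕ :=
  Nat.pair 2 (Nat.pair e (Encodable.encode (l.map (Nat.pair 0))))

/-- The code of the conjunction of the formulas with the given codes (and a trivial equation). -/
def conjCode (l : List ℕ) : ℕ :=
  l.foldr (fun c acc => notCode (Nat.pair 3 (Nat.pair c (notCode acc)))) (varEqualCode 0 0)

/-- The code `c` or its negation, according to whether `b` belongs to the guess. -/
def signedCode (A : List ℕ) (b c : ℕ) : ℕ := if b ∈ A then c else notCode c

/-- The arrangement of the variables that stand for the subterms. -/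
def equalLiterals (n : ℕ) (A : List ℕ) : List ℕ :=
  (termNodes n).flatMap fun s =>
    (termNodes n).map fun t => signedCode A (equalCode s t) (varEqualCode s t)

/-- The equations that define the values of those subterms whose outermost symbol is in the
domain of the translation `d` of symbol numbers. -/
def funcLiterals (d : ℕ → Option ℕ) (n : ℕ) : List ℕ :=
  ((termNodes n).filter fun m => tag m = 2).filterMap fun m =>
    (d (lhs m)).map fun e => equalCode (Nat.pair 0 m) (applyCode e (args m))

/-- The literals on those predicate symbols that are in the domain of the translation `d`. -/
def relLiterals (d : ℕ → Option ℕ) (n : ℕ) (A : List ℕ) : List ℕ :=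
  ((formulaNodes n).filter fun m => tag m = 2).filterMap fun m =>
    (d (lhs m)).map fun e => signedCode A m (applyCode e (args m))

/-- The literals saying that `j` variables, none of which stands for a subterm, are distinct. -/
def distinctLiterals (j : ℕ) : List ℕ :=
  (List.range j).flatMap fun a =>
    (List.range a).map fun b => notCode (varEqualCode (Nat.pair 1 a) (Nat.pair 1 b))

/-- The code of the cube consisting of all the facts above. -/
def cubeCode (d : ℕ → Option ℕ) (j n : ℕ) (A : List ℕ) : ℕ :=
  conjCode (equalLiterals n A ++ funcLiterals d n ++ relLiterals d n A ++ distinctLiterals j)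

/-- The partial function `d` on symbol numbers is inverse to the language map `ι`. -/
structure IsTranslation {L L' : FirstOrder.Language.{0, 0}} [Encodable (Σ n, L.Functions n)]
    [Encodable (Σ n, L.Relations n)] [Encodable (Σ n, L'.Functions n)]
    [Encodable (Σ n, L'.Relations n)] (ι : L' →ᴸ L) (d : ℕ → Option ℕ) : Prop where
  func : ∀ {k : ℕ} (F : L.Functions k) (e : ℕ),
    d (Encodable.encode (⟨k, F⟩ : Σ n, L.Functions n)) = some e ↔
      ∃ f : L'.Functions k, ι.onFunction f = F ∧
        Encodable.encode (⟨k, f⟩ : Σ n, L'.Functions n) = e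
  rel : ∀ {k : ℕ} (R : L.Relations k) (e : ℕ),
    d (Encodable.encode (⟨k, R⟩ : Σ n, L.Relations n)) = some e ↔
      ∃ r : L'.Relations k, ι.onRelation r = R ∧
        Encodable.encode (⟨k, r⟩ : Σ n, L'.Relations n) = e

theorem IsCube.isQF {L : FirstOrder.Language.{0, 0}} {φ : L.Formula ℕ}
    (h : IsCube φ) : BoundedFormula.IsQF φ := by
  induction h with
  | literal h =>
    rcases h with h | ⟨ψ, h, rfl⟩
    exacts [h.isQF, h.isQF.not]
  | conj _ _ h₁ h₂ => exact h₁.inf h₂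

section Cubes
variable {L : FirstOrder.Language.{0, 0}} [Encodable (Σ n, L.Functions n)]
  [Encodable (Σ n, L.Relations n)]

variable (L) in
/-- The number `c` is the code of a literal. -/
def IsLiteralCode (c : ℕ) : Prop := ∃ ψ : L.Formula ℕ, IsLiteral ψ ∧ code ψ = c

variable (L) in
/-- The equation between two variables. -/
def varEqual (i j : ℕ) : L.Formula ℕ :=
  Term.bdEqual (.var (Sum.inl i)) (.var (Sum.inl j))

/-- The equation between a variable and the value of a function symbol at variables. -/
def funcEqual (i : ℕ) {k : ℕ} (f : L.Functions k) (l : Fin k → ℕ) : L.Formula ℕ :=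
  Term.bdEqual (.var (Sum.inl i)) (.func f fun i => .var (Sum.inl (l i)))

/-- The application of a predicate symbol to variables. -/
def relApply {k : ℕ} (R : L.Relations k) (l : Fin k → ℕ) : L.Formula ℕ :=
  R.boundedFormula fun i => .var (Sum.inl (l i))

theorem code_varEqual (i j : ℕ) : code (varEqual L i j) = varEqualCode i j := rfl

theorem code_not (ψ : L.Formula ℕ) : code (Formula.not ψ) = notCode (code ψ) := rfl

theorem code_inf (φ ψ : L.Formula ℕ) :
    code (φ ⊓ ψ) = notCode (Nat.pair 3 (Nat.pair (code φ) (notCode (code ψ)))) := rfl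

theorem code_funcEqual (i : ℕ) {k : ℕ} (f : L.Functions k) (l : Fin k → ℕ) :
    code (funcEqual i f l) = equalCode (Nat.pair 0 i)
      (applyCode (Encodable.encode (⟨k, f⟩ : Σ n, L.Functions n)) (List.ofFn l)) := by
  simp only [funcEqual, Term.bdEqual, code, termCode, equalCode, applyCode, List.map_ofFn]
  rfl

theorem code_relApply {k : ℕ} (R : L.Relations k) (l : Fin k → ℕ) :
    code (relApply R l) =
      applyCode (Encodable.encode (⟨k, R⟩ : Σ n, L.Relations n)) (List.ofFn l) := by
  simp only [relApply, Relations.boundedFormula, code, termCode, applyCode, List.map_ofFn]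
  rfl

theorem isLiteralCode_of_isAtomic {ψ : L.Formula ℕ} (h : BoundedFormula.IsAtomic ψ) (A : List ℕ)
    (b : ℕ) : IsLiteralCode L (signedCode A b (code ψ)) := by
  unfold signedCode
  split_ifs
  exacts [⟨ψ, Or.inl h, rfl⟩, ⟨_, Or.inr ⟨ψ, h, rfl⟩, rfl⟩]

theorem exists_cube {l : List ℕ} (h : ∀ c ∈ l, IsLiteralCode L c) :
    ∃ Ψ : L.Formula ℕ, IsCube Ψ ∧ code Ψ = conjCode l ∧
      ∀ (M : Type) [L.Structure M] (w : ℕ → M), Ψ.Realize w ↔ ∀ c ∈ l, HoldsCode L w c := by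
  induction l with
  | nil =>
    refine ⟨varEqual L 0 0, .literal (Or.inl (.equal _ _)), rfl, fun M _ w => ?_⟩
    simp only [List.not_mem_nil, false_imp_iff, implies_true, iff_true]
    exact (rfl : w 0 = w 0)
  | cons c l ih =>
    obtain ⟨Ψ, h₁, h₂, h₃⟩ := ih fun c hc => h c (List.mem_cons_of_mem _ hc)
    obtain ⟨ψ, hψ, rfl⟩ := h c List.mem_cons_self
    refine ⟨ψ ⊓ Ψ, .conj (.literal hψ) h₁, ?_, fun M _ w => ?_⟩
    · rw [code_inf, h₂]
      rfl
    · rw [Formula.realize_inf, h₃, List.forall_mem_cons, holdsCode_code]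

theorem holdsCode_signedCode {M : Type} [L.Structure M] (w : ℕ → M) {A : List ℕ}
    {b : ℕ} {ψ : L.Formula ℕ} :
    HoldsCode L w (signedCode A b (code ψ)) ↔ (ψ.Realize w ↔ b ∈ A) := by
  unfold signedCode
  split_ifs with h
  · simp [holdsCode_code, h]
  · simp [← code_not, holdsCode_code, h]

variable {L' : FirstOrder.Language.{0, 0}} [Encodable (Σ n, L'.Functions n)]
  [Encodable (Σ n, L'.Relations n)] {ι : L' →ᴸ L} {d : ℕ → Option ℕ}

/-- This is the purification: only subterms whose head symbol comes from `L'` get a defining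
equation, and alien subterms survive merely as variables. -/
theorem mem_funcLiterals (hd : IsTranslation ι d) {φ : L.Formula ℕ} (hφ : BoundedFormula.IsQF φ)
    {c : ℕ} : c ∈ funcLiterals d (code φ) ↔
      ∃ (k : ℕ) (f : L'.Functions k) (ts : Fin k → L.Term (ℕ ⊕ Fin 0)),
        termCode (Term.func (ι.onFunction f) ts) ∈ termNodes (code φ) ∧
        c = code (funcEqual (termCode (Term.func (ι.onFunction f) ts)) f
          fun i => termCode (ts i)) := by
  simp only [funcLiterals, List.mem_filterMap, List.mem_filter, decide_eq_true_eq,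
    Option.map_eq_some_iff]
  constructor
  · rintro ⟨m, ⟨hm, h₂⟩, e, he, rfl⟩
    obtain ⟨t, rfl⟩ := exists_term_of_mem hφ hm
    cases t with
    | var x => rcases x with x | x <;> simp [termCode] at h₂
    | func F ts =>
      simp only [termCode, lhs_pair] at he
      obtain ⟨f, rfl, rfl⟩ := (hd.func _ _).1 he
      refine ⟨_, f, ts, hm, ?_⟩
      rw [code_funcEqual]
      simp [termCode]
  · rintro ⟨k, f, ts, hm, rfl⟩
    refine ⟨_, ⟨hm, by simp [termCode]⟩,
      Encodable.encode (⟨k, f⟩ : Σ n, L'.Functions n), ?_, ?_⟩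
    · simp only [termCode, lhs_pair]
      exact (hd.func _ _).2 ⟨f, rfl, rfl⟩
    · rw [code_funcEqual]
      simp [termCode]

theorem mem_relLiterals (hd : IsTranslation ι d) {φ : L.Formula ℕ} (hφ : BoundedFormula.IsQF φ)
    {A : List ℕ} {c : ℕ} : c ∈ relLiterals d (code φ) A ↔
      ∃ (k : ℕ) (R : L'.Relations k) (ts : Fin k → L.Term (ℕ ⊕ Fin 0)),
        code (BoundedFormula.rel (ι.onRelation R) ts : L.Formula ℕ) ∈ formulaNodes (code φ) ∧
        c = signedCode A (code (BoundedFormula.rel (ι.onRelation R) ts : L.Formula ℕ))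
          (code (relApply R fun i => termCode (ts i))) := by
  simp only [relLiterals, List.mem_filterMap, List.mem_filter, decide_eq_true_eq,
    Option.map_eq_some_iff]
  constructor
  · rintro ⟨m, ⟨hm, h₂⟩, e, he, rfl⟩
    obtain ⟨ψ, hψ, rfl⟩ := exists_formula_of_mem hφ hm
    cases hψ with
    | falsum => simp [code] at h₂
    | imp => simp [code] at h₂
    | of_isAtomic h =>
      cases h with
      | equal => simp [code, Term.bdEqual] at h₂
      | rel R ts =>
        simp only [Relations.boundedFormula, code, lhs_pair] at he
        obtain ⟨R, rfl, rfl⟩ := (hd.rel _ _).1 he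
        refine ⟨_, R, ts, hm, ?_⟩
        rw [code_relApply]
        simp [code, Relations.boundedFormula]
  · rintro ⟨k, R, ts, hm, rfl⟩
    refine ⟨_, ⟨hm, by simp [code]⟩,
      Encodable.encode (⟨k, R⟩ : Σ n, L'.Relations n), ?_, ?_⟩
    · simp only [code, lhs_pair]
      exact (hd.rel _ _).2 ⟨R, rfl, rfl⟩
    · rw [code_relApply]
      simp [code]

theorem exists_cube_of_guess (hd : IsTranslation ι d) {φ : L.Formula ℕ}
    (hφ : BoundedFormula.IsQF φ) (A : List ℕ) (j : ℕ) :
    ∃ Ψ : L'.Formula ℕ, IsCube Ψ ∧ code Ψ = cubeCode d j (code φ) A ∧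
      ∀ (M : Type) [L'.Structure M] (w : ℕ → M), Ψ.Realize w ↔
        Diagram ι (code φ) A M w ∧
          ∀ a < j, ∀ b < a, w (Nat.pair 1 a) ≠ w (Nat.pair 1 b) := by
  have mem_equal {c : ℕ} : c ∈ equalLiterals (code φ) A ↔ ∃ s ∈ termNodes (code φ),
      ∃ t ∈ termNodes (code φ), signedCode A (equalCode s t) (code (varEqual L' s t)) = c := by
    simp only [equalLiterals, List.mem_flatMap, List.mem_map, code_varEqual]
  have mem_distinct {c : ℕ} : c ∈ distinctLiterals j ↔ ∃ a < j, ∃ b < a,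
      code (Formula.not (varEqual L' (Nat.pair 1 a) (Nat.pair 1 b))) = c := by
    simp only [distinctLiterals, List.mem_flatMap, List.mem_map, List.mem_range, code_varEqual,
      code_not]
  obtain ⟨Ψ, h₁, h₂, h₃⟩ := exists_cube (L := L') (l := equalLiterals (code φ) A ++
      funcLiterals d (code φ) ++ relLiterals d (code φ) A ++ distinctLiterals j) <| by
    simp only [List.forall_mem_append]
    refine ⟨⟨⟨?_, ?_⟩, ?_⟩, ?_⟩ <;> intro c hc
    · obtain ⟨s, _, t, _, rfl⟩ := mem_equal.1 hc
      exact isLiteralCode_of_isAtomic (.equal _ _) _ _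
    · obtain ⟨k, f, ts, _, rfl⟩ := (mem_funcLiterals hd hφ).1 hc
      exact ⟨_, Or.inl (.equal _ _), rfl⟩
    · obtain ⟨k, R, ts, _, rfl⟩ := (mem_relLiterals hd hφ).1 hc
      exact isLiteralCode_of_isAtomic (.rel _ _) _ _
    · obtain ⟨a, _, b, _, rfl⟩ := mem_distinct.1 hc
      exact ⟨_, Or.inr ⟨_, .equal _ _, rfl⟩, rfl⟩
  refine ⟨Ψ, h₁, h₂, fun M _ w => ?_⟩
  rw [h₃]
  simp only [List.forall_mem_append]
  refine and_congr ?_ ?_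
  · constructor
    · rintro ⟨⟨h₁, h₂⟩, h₃⟩
      refine ⟨fun s hs t ht => ?_, fun k f ts hm => ?_, fun k R ts hm => ?_⟩
      · exact (holdsCode_signedCode w).1 (h₁ _ (mem_equal.2 ⟨s, hs, t, ht, rfl⟩))
      · exact (holdsCode_code _).1 (h₂ _ ((mem_funcLiterals hd hφ).2 ⟨k, f, ts, hm, rfl⟩))
      · exact (holdsCode_signedCode w).1 (h₃ _ ((mem_relLiterals hd hφ).2 ⟨k, R, ts, hm, rfl⟩))
    · intro h
      refine ⟨⟨fun c hc => ?_, fun c hc => ?_⟩, fun c hc => ?_⟩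
      · obtain ⟨s, hs, t, ht, rfl⟩ := mem_equal.1 hc
        exact (holdsCode_signedCode w).2 (h.equal s hs t ht)
      · obtain ⟨k, f, ts, hm, rfl⟩ := (mem_funcLiterals hd hφ).1 hc
        exact (holdsCode_code _).2 (h.func k f ts hm)
      · obtain ⟨k, R, ts, hm, rfl⟩ := (mem_relLiterals hd hφ).1 hc
        exact (holdsCode_signedCode w).2 (h.rel k R ts hm)
  · constructor
    · intro h a ha b hb
      exact (holdsCode_code _).1 (h _ (mem_distinct.2 ⟨a, ha, b, hb, rfl⟩))
    · intro h c hc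
      obtain ⟨a, ha, b, hb, rfl⟩ := mem_distinct.1 hc
      exact (holdsCode_code (L := L') _).2 (h a ha b hb)

end Cubes

/-! ### Computability of the syntactic operations -/

section Primrec
variable {α β : Type*} [Primcodable α] [Primcodable β]

theorem primrecRel_mem : PrimrecRel fun (a : α) (l : List α) => a ∈ l := by
  have : PrimrecRel fun (l : List α) (a : α) => ∃ b ∈ l, b = a :=
    PrimrecRel.exists_mem_list Primrec.eq
  exact this.swap.of_eq fun a l => by simp

theorem primrecPred_forall_mem {l : α → List β} {R : β → α → Prop} (hl : Primrec l)
    (hR : PrimrecRel R) : PrimrecPred fun a => ∀ b ∈ l a, R b a :=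
  (PrimrecRel.forall_mem_list hR).comp hl .id

theorem primrec_sublists' : Primrec (List.sublists' : List α → List (List α)) := by
  have h : Primrec fun l : List α =>
      l.foldr (fun a acc => acc ++ acc.map (List.cons a)) [ [] ] := by
    refine Primrec.list_foldr (f := fun l : List α => l)
      (h := fun _ (x : α × List (List α)) => x.2 ++ x.2.map (List.cons x.1)) .id (.const _) ?_
    refine Primrec.list_append.comp (Primrec.snd.comp .snd) ?_
    exact Primrec.list_map (Primrec.snd.comp .snd)
      (Primrec.list_cons.comp (Primrec.fst.comp (Primrec.snd.comp .fst)) .snd)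
  refine h.of_eq fun l => ?_
  induction l with
  | nil => rfl
  | cons a l ih => rw [List.foldr_cons, ih, List.sublists'_cons]

end Primrec

theorem primrec_tag : Primrec tag := Primrec.fst.comp .unpair

theorem primrec_lhs : Primrec lhs :=
  Primrec.fst.comp (Primrec.unpair.comp (Primrec.snd.comp .unpair))

theorem primrec_rhs : Primrec rhs :=
  Primrec.snd.comp (Primrec.unpair.comp (Primrec.snd.comp .unpair))

theorem primrec_args : Primrec args := (Primrec.ofNat (List ℕ)).comp primrec_rhs

theorem primrec_constituents : Primrec constituents := by
  have htag (k : ℕ) : PrimrecPred fun x : Bool × ℕ => tag x.2 = k :=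
    Primrec.eq.comp (primrec_tag.comp .snd) (.const k)
  have hfst : PrimrecPred fun x : Bool × ℕ => x.1 = true := Primrec.eq.comp .fst (.const true)
  have hpair (b : Bool) : Primrec fun x : Bool × ℕ => [(b, lhs x.2), (b, rhs x.2)] :=
    Primrec.list_cons.comp (.pair (.const b) (primrec_lhs.comp .snd))
      (Primrec.list_cons.comp (.pair (.const b) (primrec_rhs.comp .snd)) (.const []))
  exact .ite (htag 2)
    (Primrec.list_map (primrec_args.comp .snd) (Primrec.pair (.const false) .snd))
    (.ite (hfst.and (htag 1)) (hpair false) (.ite (hfst.and (htag 3)) (hpair true) (.const [])))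

theorem primrec_nodes : Primrec nodes := by
  refine Primrec.nat_iterate (f := fun n : ℕ => n.succ) (g := fun n => [(true, n)])
    (h := fun _ l => l ++ l.flatMap constituents) .succ
    (Primrec.list_cons.comp (.pair (.const true) .id) (.const [])) ?_
  exact Primrec.list_append.comp .snd
    (Primrec.list_flatMap .snd (primrec_constituents.comp .snd))

theorem primrec_termNodes : Primrec termNodes :=
  Primrec.list_map
    ((Primrec.listFilter (Primrec.eq.comp .fst (.const false))).comp primrec_nodes)
    (Primrec.snd.comp .snd)

theorem primrec_formulaNodes : Primrec formulaNodes :=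
  Primrec.list_map
    ((Primrec.listFilter (Primrec.eq.comp .fst (.const true))).comp primrec_nodes)
    (Primrec.snd.comp .snd)

theorem primrec_equalCode : Primrec₂ equalCode :=
  Primrec₂.natPair.comp (.const 1) Primrec₂.natPair

theorem primrec_candidates : Primrec candidates :=
  Primrec.list_append.comp primrec_formulaNodes <|
    Primrec.list_flatMap primrec_termNodes <|
      Primrec.list_map (primrec_termNodes.comp .fst)
        (primrec_equalCode.comp (Primrec.snd.comp .fst) .snd)

theorem primrec_guesses : Primrec guesses := primrec_sublists'.comp primrec_candidates

theorem primrecRel_consistent : PrimrecRel Consistent := by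
  have mem {γ : Type} [Primcodable γ] {f : γ → ℕ} {g : γ → List ℕ} (hf : Primrec f)
      (hg : Primrec g) : PrimrecPred fun c => f c ∈ g c := primrecRel_mem.comp hf hg
  have imp {γ : Type} [Primcodable γ] {p q : γ → Prop} (hp : PrimrecPred p)
      (hq : PrimrecPred q) : PrimrecPred fun c => p c → q c :=
    (hp.not.or hq).of_eq fun c => by tauto
  have hA : Primrec fun x : ℕ × ℕ × List ℕ => x.2.2 := Primrec.snd.comp .snd
  have hm := mem .fst hA
  have hl := mem (primrec_lhs.comp .fst) hA
  have hr := mem (primrec_rhs.comp .fst) hA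
  have htag (k : ℕ) : PrimrecPred fun x : ℕ × ℕ × List ℕ => tag x.1 = k :=
    Primrec.eq.comp (primrec_tag.comp .fst) (.const k)
  have h : PrimrecRel fun (m : ℕ) (p : ℕ × List ℕ) => (tag m = 0 → m ∉ p.2) ∧
      (tag m = 3 → (m ∈ p.2 ↔ (lhs m ∈ p.2 → rhs m ∈ p.2))) := by
    refine (imp (htag 0) hm.not).and (imp (htag 3) ?_)
    exact ((imp hm (imp hl hr)).and (imp (imp hl hr) hm)).of_eq fun c => iff_def.symm
  exact (mem .fst .snd).and (primrecPred_forall_mem (primrec_formulaNodes.comp .fst) h)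

theorem primrec_varEqualCode : Primrec₂ varEqualCode :=
  primrec_equalCode.comp (Primrec₂.natPair.comp (.const 0) .fst)
    (Primrec₂.natPair.comp (.const 0) .snd)

theorem primrec_notCode : Primrec notCode :=
  Primrec₂.natPair.comp (.const 3) (Primrec₂.natPair.comp .id (.const _))

theorem primrec_applyCode : Primrec₂ applyCode :=
  Primrec₂.natPair.comp (.const 2) <| Primrec₂.natPair.comp .fst <| Primrec.encode.comp <|
    Primrec.list_map .snd (Primrec₂.natPair.comp (.const 0) .snd)

theorem primrec_conjCode : Primrec conjCode := by
  refine Primrec.list_foldr (f := fun l : List ℕ => l)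
    (h := fun _ (x : ℕ × ℕ) => notCode (Nat.pair 3 (Nat.pair x.1 (notCode x.2)))) .id (.const _) ?_
  refine primrec_notCode.comp (Primrec₂.natPair.comp (.const 3) ?_)
  exact Primrec₂.natPair.comp (Primrec.fst.comp .snd)
    (primrec_notCode.comp (Primrec.snd.comp .snd))

theorem primrec_signedCode {α : Type} [Primcodable α] {A : α → List ℕ} {b c : α → ℕ}
    (hA : Primrec A) (hb : Primrec b) (hc : Primrec c) :
    Primrec fun x => signedCode (A x) (b x) (c x) :=
  .ite (primrecRel_mem.comp hb hA) hc (primrec_notCode.comp hc)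

theorem primrec_equalLiterals : Primrec₂ equalLiterals := by
  refine Primrec.list_flatMap (primrec_termNodes.comp .fst) ?_
  refine Primrec.list_map (primrec_termNodes.comp (Primrec.fst.comp .fst)) ?_
  have hs : Primrec fun x : ((ℕ × List ℕ) × ℕ) × ℕ => x.1.2 := Primrec.snd.comp .fst
  exact primrec_signedCode (Primrec.snd.comp (Primrec.fst.comp .fst))
    (primrec_equalCode.comp hs .snd) (primrec_varEqualCode.comp hs .snd)

theorem primrec_tag_filter : Primrec fun l : List ℕ => l.filter fun m => tag m = 2 :=
  Primrec.listFilter (Primrec.eq.comp primrec_tag (.const 2))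

theorem primrec_funcLiterals {d : ℕ → Option ℕ} (hd : Primrec d) : Primrec (funcLiterals d) := by
  refine Primrec.listFilterMap (primrec_tag_filter.comp primrec_termNodes) ?_
  refine Primrec.option_map (hd.comp (primrec_lhs.comp .snd)) ?_
  have hm : Primrec fun x : (ℕ × ℕ) × ℕ => x.1.2 := Primrec.snd.comp .fst
  exact primrec_equalCode.comp (Primrec₂.natPair.comp (.const 0) hm)
    (primrec_applyCode.comp .snd (primrec_args.comp hm))

theorem primrec_relLiterals {d : ℕ → Option ℕ} (hd : Primrec d) : Primrec₂ (relLiterals d) := by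
  refine Primrec.listFilterMap (primrec_tag_filter.comp (primrec_formulaNodes.comp .fst)) ?_
  refine Primrec.option_map (hd.comp (primrec_lhs.comp .snd)) ?_
  have hm : Primrec fun x : ((ℕ × List ℕ) × ℕ) × ℕ => x.1.2 := Primrec.snd.comp .fst
  exact primrec_signedCode (Primrec.snd.comp (Primrec.fst.comp .fst)) hm
    (primrec_applyCode.comp .snd (primrec_args.comp hm))

theorem primrec_distinctLiterals : Primrec distinctLiterals := by
  refine Primrec.list_flatMap Primrec.list_range ?_
  refine Primrec.list_map (Primrec.list_range.comp .snd) ?_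
  exact primrec_notCode.comp <| primrec_varEqualCode.comp
    (Primrec₂.natPair.comp (.const 1) (Primrec.snd.comp .fst))
    (Primrec₂.natPair.comp (.const 1) .snd)

theorem primrec_cubeCode {d : ℕ → Option ℕ} (hd : Primrec d) {α : Type} [Primcodable α]
    {j n : α → ℕ} {A : α → List ℕ} (hj : Primrec j) (hn : Primrec n) (hA : Primrec A) :
    Primrec fun x => cubeCode d (j x) (n x) (A x) :=
  primrec_conjCode.comp <| Primrec.list_append.comp (Primrec.list_append.comp
    (Primrec.list_append.comp (primrec_equalLiterals.comp hn hA)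
      ((primrec_funcLiterals hd).comp hn)) ((primrec_relLiterals hd).comp hn hA))
    (primrec_distinctLiterals.comp hj)

/-- A loop over the positions of the list with one boolean accumulator. -/
theorem computable_any {α β : Type} [Primcodable α] [Primcodable β] {l : α → List β}
    {p : α → β → Bool} (hl : Computable l) (hp : Computable₂ p) :
    Computable fun a => (l a).any (p a) := by
  have h : Computable fun a => Nat.rec (motive := fun _ => Bool) false
      (fun i b => b || (((l a)[i]?).map (p a)).getD false) (l a).length := by
    refine Computable.nat_rec (h := fun a x => x.2 || (((l a)[x.1]?).map (p a)).getD false)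
      (Computable.list_length.comp hl) (.const _) ?_
    refine Primrec.or.to_comp.comp (Computable.snd.comp .snd) ?_
    refine Computable.option_getD (Computable.option_map ?_ ?_) (.const _)
    · exact Computable.list_getElem?.comp (hl.comp .fst) (Computable.fst.comp .snd)
    · exact hp.comp (Computable.fst.comp .fst) .snd
  refine h.of_eq fun a => ?_
  generalize p a = q, l a = l
  -- Loop invariant: after `k` rounds the accumulator is the answer for the first `k` entries.
  suffices ∀ k ≤ l.length, Nat.rec (motive := fun _ => Bool) false
      (fun i b => b || ((l[i]?).map q).getD false) k = (l.take k).any q by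
    rw [this _ le_rfl, List.take_length]
  intro k hk
  induction k with
  | zero => simp
  | succ k ih =>
    have : k < l.length := by omega
    rw [List.take_succ_eq_append_getElem this, List.any_append, ← ih this.le]
    simp [List.getElem?_eq_getElem this]

/-- A guess-and-check procedure whose check is computable is computable. -/
theorem computable_exists_guess {α : Type} [Primcodable α] {n : α → ℕ}
    {test : α → List ℕ → Bool} (hn : Computable n) (htest : Computable₂ test) :
    ∃ f : α → Bool, Computable f ∧ ∀ a, f a = true ↔
      ∃ A ∈ guesses (n a), Consistent (n a) A ∧ test a A = true := by
  classical
  refine ⟨fun a => (guesses (n a)).any fun A => decide (Consistent (n a) A) && test a A,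
    computable_any (primrec_guesses.to_comp.comp hn) ?_, fun a => by simp⟩
  exact Primrec.and.to_comp.comp
    (primrecRel_consistent.decide.to_comp.comp (hn.comp .fst) .snd) htest

/-! ### Spectra, and the combination of models -/

/-! ### Symbol numbers of the disjoint union: parity tells the summand. -/

section Translations

theorem isTranslation_id {L : FirstOrder.Language.{0, 0}} [Encodable (Σ n, L.Functions n)]
    [Encodable (Σ n, L.Relations n)] : IsTranslation (LHom.id L) some where
  func F e := by simp [LHom.id]
  rel R e := by simp [LHom.id]

/-- The translation of symbol numbers to the first summand. -/
def leftNumber (e : ℕ) : Option ℕ := if e % 2 = 0 then some (e / 2) else none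

/-- The translation of symbol numbers to the second summand. -/
def rightNumber (e : ℕ) : Option ℕ := if e % 2 = 1 then some (e / 2) else none

theorem primrec_number (r : ℕ) :
    Primrec fun e : ℕ => if e % 2 = r then some (e / 2) else none :=
  .ite (Primrec.eq.comp (Primrec.nat_mod.comp .id (.const 2)) (.const r))
    (Primrec.option_some.comp (Primrec.nat_div.comp .id (.const 2))) (.const none)

variable {L₁ L₂ : FirstOrder.Language.{0, 0}}

section
variable [Encodable (Σ n, L₁.Functions n)] [Encodable (Σ n, L₂.Functions n)]

theorem encode_func_inl {k : ℕ} (f : L₁.Functions k) :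
    Encodable.encode (⟨k, Sum.inl f⟩ : Σ n, (L₁.sum L₂).Functions n) =
      2 * Encodable.encode (⟨k, f⟩ : Σ n, L₁.Functions n) := rfl

theorem encode_func_inr {k : ℕ} (f : L₂.Functions k) :
    Encodable.encode (⟨k, Sum.inr f⟩ : Σ n, (L₁.sum L₂).Functions n) =
      2 * Encodable.encode (⟨k, f⟩ : Σ n, L₂.Functions n) + 1 := rfl

end

section
variable [Encodable (Σ n, L₁.Relations n)] [Encodable (Σ n, L₂.Relations n)]

theorem encode_rel_inl {k : ℕ} (R : L₁.Relations k) :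
    Encodable.encode (⟨k, Sum.inl R⟩ : Σ n, (L₁.sum L₂).Relations n) =
      2 * Encodable.encode (⟨k, R⟩ : Σ n, L₁.Relations n) := rfl

theorem encode_rel_inr {k : ℕ} (R : L₂.Relations k) :
    Encodable.encode (⟨k, Sum.inr R⟩ : Σ n, (L₁.sum L₂).Relations n) =
      2 * Encodable.encode (⟨k, R⟩ : Σ n, L₂.Relations n) + 1 := rfl

end

variable [Encodable (Σ n, L₁.Functions n)] [Encodable (Σ n, L₁.Relations n)]
  [Encodable (Σ n, L₂.Functions n)] [Encodable (Σ n, L₂.Relations n)]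

theorem isTranslation_left : IsTranslation (LHom.sumInl : L₁ →ᴸ L₁.sum L₂) leftNumber where
  func F e := by
    rcases F with f | f
    · rw [encode_func_inl]
      simp [leftNumber, LHom.sumInl]
      exact ⟨fun h => ⟨f, rfl, h⟩, fun ⟨_, h₁, h₂⟩ => Sum.inl_injective h₁ ▸ h₂⟩
    · rw [encode_func_inr]
      simp [leftNumber, LHom.sumInl]
  rel R e := by
    rcases R with R | R
    · rw [encode_rel_inl]
      simp [leftNumber, LHom.sumInl]
      exact ⟨fun h => ⟨R, rfl, h⟩, fun ⟨_, h₁, h₂⟩ => Sum.inl_injective h₁ ▸ h₂⟩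
    · rw [encode_rel_inr]
      simp [leftNumber, LHom.sumInl]

theorem isTranslation_right : IsTranslation (LHom.sumInr : L₂ →ᴸ L₁.sum L₂) rightNumber where
  func F e := by
    rcases F with f | f
    · rw [encode_func_inl]
      simp [rightNumber, LHom.sumInr]
    · rw [encode_func_inr]
      simp [rightNumber, LHom.sumInr, show ∀ x, (2 * x + 1) / 2 = x by omega]
      exact ⟨fun h => ⟨f, rfl, h⟩, fun ⟨_, h₁, h₂⟩ => Sum.inr_injective h₁ ▸ h₂⟩
  rel R e := by
    rcases R with R | R
    · rw [encode_rel_inl]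
      simp [rightNumber, LHom.sumInr]
    · rw [encode_rel_inr]
      simp [rightNumber, LHom.sumInr, show ∀ x, (2 * x + 1) / 2 = x by omega]
      exact ⟨fun h => ⟨R, rfl, h⟩, fun ⟨_, h₁, h₂⟩ => Sum.inr_injective h₁ ▸ h₂⟩

end Translations

/-- Downward Löwenheim–Skolem: an uncountable model is replaced by a countable elementary
substructure containing the values of all variables. -/
theorem Satisfiable.exists_mem_spec {L : FirstOrder.Language.{0, 0}}
    [Encodable (Σ n, L.Functions n)] [Encodable (Σ n, L.Relations n)] {T : L.Theory}
    {φ : L.Formula ℕ} (h : Satisfiable T φ) : ∃ κ, κ ∈ Spec T φ := by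
  obtain ⟨M, _, v, hT, hφ⟩ := h
  rcases le_total #M ℵ₀ with hM | hM
  · exact ⟨_, hM, M, _, v, hT, hφ, rfl⟩
  · have hL : L.card ≤ ℵ₀ := by
      rw [Language.card]
      have : Countable L.Symbols := inferInstanceAs (Countable (_ ⊕ _))
      exact Cardinal.mk_le_aleph0
    obtain ⟨S, hS, hcard⟩ := exists_elementarySubstructure_card_eq L (Set.range v)
      (ℵ₀ : Cardinal.{0}) le_rfl
      (by simpa using (Set.countable_range v).le_aleph0) (by simpa using hL) (by simpa using hM)
    refine ⟨ℵ₀, le_rfl, S, inferInstance, fun i => ⟨v i, hS ⟨i, rfl⟩⟩, inferInstance, ?_,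
      by simpa using hcard⟩
    exact (S.subtype.map_formula φ _).1 hφ

/-- Tag `1` marks bound variables, absent here. Hence the variables numbered `Nat.pair 1 a` are
fresh: none of them names a subterm. -/
theorem tag_termCode_ne_one {L : FirstOrder.Language.{0, 0}} [Encodable (Σ n, L.Functions n)]
    (t : L.Term (ℕ ⊕ Fin 0)) : tag (termCode t) ≠ 1 := by
  rcases t with (x | x) | _
  · simp [termCode]
  · exact x.elim0
  · simp [termCode]

section Diagram
variable {L L' : FirstOrder.Language.{0, 0}} [Encodable (Σ n, L.Functions n)]
  [Encodable (Σ n, L.Relations n)] {ι : L' →ᴸ L}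

/-- A diagram constrains `w` only at subterm codes. This serves both to transport models and, with
the identity, to reassign fresh variables. -/
theorem Diagram.of_equiv {n : ℕ} {A : List ℕ} {M N : Type} [L'.Structure M] [L'.Structure N]
    {w : ℕ → M} {w' : ℕ → N} (h : Diagram ι n A M w) (e : M ≃[L'] N)
    (hw : ∀ s ∈ termNodes n, w' s = e (w s)) : Diagram ι n A N w' where
  equal s hs t ht := by rw [hw s hs, hw t ht, e.injective.eq_iff, h.equal s hs t ht]
  func k f ts hm := by
    simp only [hw _ hm, hw _ (mem_termNodes_of_func hm _), h.func k f ts hm]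
    exact e.map_fun f _
  rel k R ts hm := by
    simp only [hw _ (mem_termNodes_of_rel hm _)]
    exact (e.map_rel R _).trans (h.rel k R ts hm)

variable [Encodable (Σ n, L'.Functions n)] [Encodable (Σ n, L'.Relations n)]

/-- The requirement that there be at least `j` elements can be added to the cube of a guess. -/
theorem satisfiable_cube_iff {T : L'.Theory} {φ : L.Formula ℕ} (hφ : BoundedFormula.IsQF φ)
    {A : List ℕ} {j : ℕ} {Ψ₀ Ψ : L'.Formula ℕ}
    (h₀ : ∀ (M : Type) [L'.Structure M] (w : ℕ → M), Ψ₀.Realize w ↔ Diagram ι (code φ) A M w)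
    (h : ∀ (M : Type) [L'.Structure M] (w : ℕ → M), Ψ.Realize w ↔ Diagram ι (code φ) A M w ∧
      ∀ a < j, ∀ b < a, w (Nat.pair 1 a) ≠ w (Nat.pair 1 b)) :
    Satisfiable T Ψ ↔ ∃ κ ∈ Spec T Ψ₀, (j : Cardinal) ≤ κ := by
  constructor
  · intro hs
    obtain ⟨κ, hκ, M, _, w, hT, hw, hM⟩ := hs.exists_mem_spec
    obtain ⟨hd, hj⟩ := (h M w).1 hw
    refine ⟨κ, ⟨hκ, M, _, w, hT, (h₀ M w).2 hd, hM⟩, ?_⟩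
    have hinj : Function.Injective fun a : Fin j => w (Nat.pair 1 a) := by
      intro a b hab
      rcases lt_trichotomy a b with hlt | rfl | hlt
      exacts [(hj b b.2 a hlt hab.symm).elim, rfl, (hj a a.2 b hlt hab).elim]
    rw [← hM]
    simpa using Cardinal.mk_le_of_injective hinj
  · rintro ⟨κ, ⟨hκ, M, _, w, hT, hw, rfl⟩, hj⟩
    obtain ⟨g⟩ : Nonempty (Fin j ↪ M) := by
      rw [← Cardinal.le_def]
      simpa using hj
    -- Only the fresh variables change: the first `j` of them receive the distinct elements supplied
    -- by `g`.
    let w' : ℕ → M := fun c =>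
      if tag c = 1 then if hc : c.unpair.2 < j then g ⟨_, hc⟩ else w 0 else w c
    refine ⟨M, _, w', hT, (h M w').2 ⟨?_, ?_⟩⟩
    · refine ((h₀ M w).1 hw).of_equiv (Language.Equiv.refl L' M) fun s hs => ?_
      obtain ⟨t, rfl⟩ := exists_term_of_mem hφ hs
      simp [w', tag_termCode_ne_one t]
    · intro a ha b hb hab
      have hb' := hb.trans ha
      simp [w', ha, hb'] at hab
      omega

end Diagram

/-- Both lists of values have the same pattern of equalities, so `w s ↦ w' s` is a well-defined
injection on a finite set. It extends to a bijection because finitely many points can be prescribed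
between equipotent sets. -/
theorem exists_equiv_extending {M N : Type} (hMN : #M = #N) {l : List ℕ} {w : ℕ → M}
    {w' : ℕ → N} (h : ∀ s ∈ l, ∀ t ∈ l, (w s = w t ↔ w' s = w' t)) :
    ∃ e : M ≃ N, ∀ s ∈ l, w' s = e (w s) := by
  let S : Set M := w '' {s | s ∈ l}
  have hS : S.Finite := (List.finite_toSet l).image w
  choose p hp hpw using fun x : S => x.2
  let f : S ↪ N := ⟨fun x => w' (p x), fun x y hxy => by
    have := (h _ (hp x) _ (hp y)).2 hxy
    rwa [hpw, hpw, ← Subtype.ext_iff] at this⟩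
  have hMN' : Nonempty (M ≃ N) := Cardinal.eq.1 hMN
  obtain ⟨e, he⟩ : ∃ e : M ≃ N, ∀ x : S, e x = f x := by
    rcases finite_or_infinite M with hM | hM
    · exact Cardinal.extend_function_finite f hMN'
    · refine Cardinal.extend_function_of_lt f ?_ hMN'
      exact (Cardinal.lt_aleph0_iff_set_finite.2 hS).trans_le (Cardinal.aleph0_le_mk M)
  refine ⟨e, fun s hs => ?_⟩
  let x : S := ⟨w s, s, hs, rfl⟩
  refine Eq.trans ?_ (he x).symm
  exact ((h _ (hp x) s hs).1 (hpw x)).symm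

/-! ### Gluing models of the two theories, and splitting models of the combination. -/

section Combination
variable {L₁ L₂ : FirstOrder.Language.{0, 0}}
  [Encodable (Σ n, L₁.Functions n)] [Encodable (Σ n, L₁.Relations n)]
  [Encodable (Σ n, L₂.Functions n)] [Encodable (Σ n, L₂.Relations n)]
  {T₁ : L₁.Theory} {T₂ : L₂.Theory}

/-- The second structure is moved onto the first domain by a bijection matching the values of all
subterms. Both diagrams then hold for the same `w₁`, and together they form a diagram over the
union. -/
theorem satisfiable_combine_of_diagrams {φ : (L₁.sum L₂).Formula ℕ}
    (hφ : BoundedFormula.IsQF φ) {A : List ℕ} (hA : Consistent (code φ) A) {M₁ M₂ : Type}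
    [L₁.Structure M₁] [L₂.Structure M₂] (h₁ : M₁ ⊨ T₁) (h₂ : M₂ ⊨ T₂) (hM : #M₂ = #M₁)
    {w₁ : ℕ → M₁} {w₂ : ℕ → M₂} (d₁ : Diagram (LHom.sumInl : L₁ →ᴸ L₁.sum L₂) (code φ) A M₁ w₁)
    (d₂ : Diagram (LHom.sumInr : L₂ →ᴸ L₁.sum L₂) (code φ) A M₂ w₂) :
    Satisfiable (combine T₁ T₂) φ := by
  obtain ⟨e, he⟩ := exists_equiv_extending hM (l := termNodes (code φ)) (w := w₂) (w' := w₁)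
    fun s hs t ht => (d₂.equal s hs t ht).trans (d₁.equal s hs t ht).symm
  let : L₂.Structure M₁ := e.inducedStructure
  have d₂' := d₂.of_equiv e.inducedStructureEquiv (w' := w₁) he
  have h₂' : M₁ ⊨ T₂ := StrongHomClass.theory_model (e.inducedStructureEquiv (L := L₂))
  obtain ⟨v, hv⟩ := realize_of_diagram hφ (M := M₁) (w := w₁) hA
    { equal := d₁.equal
      func := fun k f ts hm => by
        rcases f with f | f
        exacts [d₁.func k f ts hm, d₂'.func k f ts hm]
      rel := fun k R ts hm => by
        rcases R with R | R
        exacts [d₁.rel k R ts hm, d₂'.rel k R ts hm] }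
  exact ⟨M₁, _, v, ((LHom.onTheory_model _ _).2 h₁).union ((LHom.onTheory_model _ _).2 h₂'), hv⟩

theorem exists_diagrams_of_satisfiable {φ : (L₁.sum L₂).Formula ℕ}
    (hφ : BoundedFormula.IsQF φ) (h : Satisfiable (combine T₁ T₂) φ) :
    ∃ A ∈ guesses (code φ), Consistent (code φ) A ∧ ∃ (M : Type) (_ : L₁.Structure M)
      (_ : L₂.Structure M) (w : ℕ → M), #M ≤ ℵ₀ ∧ M ⊨ T₁ ∧ M ⊨ T₂ ∧
        Diagram (LHom.sumInl : L₁ →ᴸ L₁.sum L₂) (code φ) A M w ∧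
        Diagram (LHom.sumInr : L₂ →ᴸ L₁.sum L₂) (code φ) A M w := by
  obtain ⟨κ, hκ, M, _, v, hT, hv, rfl⟩ := h.exists_mem_spec
  obtain ⟨A, hA, hc, w, d⟩ := exists_diagram_of_realize hφ hv
  let : L₁.Structure M := (LHom.sumInl : L₁ →ᴸ L₁.sum L₂).reduct M
  let : L₂.Structure M := (LHom.sumInr : L₂ →ᴸ L₁.sum L₂).reduct M
  have : (LHom.sumInl : L₁ →ᴸ L₁.sum L₂).IsExpansionOn M := LHom.isExpansionOn_reduct _ _
  have : (LHom.sumInr : L₂ →ᴸ L₁.sum L₂).IsExpansionOn M := LHom.isExpansionOn_reduct _ _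
  refine ⟨A, hA, hc, M, _, _, w, hκ, ?_, ?_, ⟨d.equal, ?_, ?_⟩, ⟨d.equal, ?_, ?_⟩⟩
  · exact (LHom.onTheory_model LHom.sumInl _).1 (hT.mono Set.subset_union_left)
  · exact (LHom.onTheory_model LHom.sumInr _).1 (hT.mono Set.subset_union_right)
  · exact fun k f ts hm => d.func k (Sum.inl f) ts hm
  · exact fun k R ts hm => d.rel k (Sum.inl R) ts hm
  · exact fun k f ts hm => d.func k (Sum.inr f) ts hm
  · exact fun k R ts hm => d.rel k (Sum.inr R) ts hm

end Combination

/-! ### The gentle combination theorem -/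

/-- The common part of the two spectra is non-empty, given the spectrum of the first formula as a
pair `p` of a boolean and a list, the finite part `g` of the second spectrum, and whether `f j`
the second spectrum has an element `≥ j`. -/
def spectraMeet (p : Bool × List ℕ) (g f : ℕ → Bool) : Bool :=
  bif p.1 then p.2.any g
  else (List.range (p.2.sum + 1)).any (fun k => decide (0 < k ∧ k ∉ p.2) && g k) ||
    f (p.2.sum + 1)

/-- In the cofinite case, `p.2.sum + 1` exceeds every excluded size, so any element of `S₂` from
there on lies in `S₁` too. No knowledge of which element it is, or whether it is finite, is
required. -/
theorem spectraMeet_iff {p : Bool × List ℕ} {g f : ℕ → Bool} {S₁ S₂ : Set Cardinal.{0}}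
    (hpos : ∀ n ∈ p.2, 0 < n)
    (htrue : p.1 = true → S₁ = {κ | ∃ n ∈ p.2, κ = (n : Cardinal)})
    (hfalse : p.1 = false → S₁ = {κ | 0 < κ ∧ κ ≤ ℵ₀ ∧ ¬ ∃ n ∈ p.2, κ = (n : Cardinal)})
    (hg : ∀ k : ℕ, 0 < k → (g k = true ↔ (k : Cardinal) ∈ S₂))
    (hf : ∀ j : ℕ, f j = true ↔ ∃ κ ∈ S₂, (j : Cardinal) ≤ κ)
    (hS₂ : ∀ κ ∈ S₂, 0 < κ ∧ κ ≤ ℵ₀) :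
    spectraMeet p g f = true ↔ (S₁ ∩ S₂).Nonempty := by
  obtain ⟨b, l⟩ := p
  cases b with
  | true =>
    rw [htrue rfl]
    simp only [spectraMeet, cond_true, List.any_eq_true]
    constructor
    · rintro ⟨n, hn, hgn⟩
      exact ⟨n, ⟨n, hn, rfl⟩, (hg n (hpos n hn)).1 hgn⟩
    · rintro ⟨_, ⟨n, hn, rfl⟩, h⟩
      exact ⟨n, hn, (hg n (hpos n hn)).2 h⟩
  | false =>
    rw [hfalse rfl]
    simp only [spectraMeet, cond_false, Bool.or_eq_true, List.any_eq_true, Bool.and_eq_true,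
      decide_eq_true_eq, List.mem_range, hf]
    constructor
    · rintro (⟨k, -, ⟨hk, hkl⟩, hgk⟩ | ⟨κ, hκ, hle⟩)
      · have hkS := (hg k hk).1 hgk
        refine ⟨k, ⟨(hS₂ _ hkS).1, (hS₂ _ hkS).2, ?_⟩, hkS⟩
        rintro ⟨n, hn, h⟩
        exact hkl (Nat.cast_injective h ▸ hn)
      · refine ⟨κ, ⟨(hS₂ κ hκ).1, (hS₂ κ hκ).2, ?_⟩, hκ⟩
        rintro ⟨n, hn, rfl⟩
        have := List.single_le_sum (fun _ _ => Nat.zero_le _) n hn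
        have := Nat.cast_le.1 hle
        omega
    · rintro ⟨κ, ⟨hpos, hle, hn⟩, hκ⟩
      rcases le_or_gt ((l.sum + 1 : ℕ) : Cardinal) κ with h | h
      · exact Or.inr ⟨κ, hκ, h⟩
      · obtain ⟨k, rfl⟩ := Cardinal.lt_aleph0.1 (h.trans Cardinal.natCast_lt_aleph0)
        have hk : 0 < k := by exact_mod_cast hpos
        exact Or.inl ⟨k, by exact_mod_cast h, ⟨hk, fun hkl => hn ⟨k, hkl, rfl⟩⟩, (hg k hk).2 hκ⟩

theorem computable_spectraMeet {α : Type} [Primcodable α] {p : α → Bool × List ℕ}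
    {g f : α → ℕ → Bool} (hp : Computable p) (hg : Computable₂ g) (hf : Computable₂ f) :
    Computable fun a => spectraMeet (p a) (g a) (f a) := by
  have hsum : Primrec fun l : List ℕ => l.sum + 1 := by
    have : Primrec fun l : List ℕ => l.foldr (fun a b => a + b) 0 :=
      Primrec.list_foldr (f := fun l : List ℕ => l) (h := fun _ (x : ℕ × ℕ) => x.1 + x.2) .id
        (.const _) (Primrec.nat_add.comp (Primrec.fst.comp .snd) (Primrec.snd.comp .snd))
    exact Primrec.succ.comp (this.of_eq fun l => rfl)
  have hbound : Computable fun a => (p a).2.sum + 1 := hsum.to_comp.comp (Computable.snd.comp hp)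
  have htest : PrimrecPred fun x : ℕ × List ℕ => 0 < x.1 ∧ x.1 ∉ x.2 :=
    (Primrec.nat_lt.comp (.const 0) .fst).and (primrecRel_mem.comp .fst .snd).not
  refine Computable.cond (Computable.fst.comp hp) (computable_any (Computable.snd.comp hp) hg)
    (Primrec.or.to_comp.comp (computable_any ?_ ?_) (hf.comp .id hbound))
  · exact Primrec.list_range.to_comp.comp hbound
  · refine Primrec.and.to_comp.comp ?_ hg
    exact htest.decide.to_comp.comp
      (.pair .snd (Computable.snd.comp (hp.comp .fst)))

theorem Spec.pos {L : FirstOrder.Language.{0, 0}} {T : L.Theory} {φ : L.Formula ℕ} {κ : Cardinal}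
    (h : κ ∈ Spec T φ) : 0 < κ := by
  obtain ⟨_, M, _, v, _, _, rfl⟩ := h
  have : Nonempty M := ⟨v 0⟩
  exact Cardinal.mk_ne_zero M |>.bot_lt

theorem isDecidable_combine {L₁ L₂ : FirstOrder.Language.{0, 0}}
    [Encodable (Σ n, L₁.Functions n)] [Encodable (Σ n, L₁.Relations n)]
    [Encodable (Σ n, L₂.Functions n)] [Encodable (Σ n, L₂.Relations n)]
    {T₁ : L₁.Theory} {T₂ : L₂.Theory} (h₁ : IsGentle T₁) (h₂ : IsDecidable T₂)
    (h₂' : HasComputableFiniteSpectra T₂) : IsDecidable (combine T₁ T₂) := by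
  obtain ⟨f₁, hf₁, H₁⟩ := h₁
  obtain ⟨f₂, hf₂, H₂⟩ := h₂
  obtain ⟨g₂, hg₂, G₂⟩ := h₂'
  have hc {α : Type} [Primcodable α] {j n : α → ℕ} {A : α → List ℕ} :
      Primrec j → Primrec n → Primrec A →
        Primrec fun x => cubeCode rightNumber (j x) (n x) (A x) :=
    primrec_cubeCode (primrec_number 1)
  obtain ⟨f, hf, H⟩ := computable_exists_guess (n := fun n : ℕ => n)
    (test := fun n A => spectraMeet (f₁ (cubeCode leftNumber 0 n A))
      (fun k => g₂ (cubeCode rightNumber 0 n A) k) fun j => f₂ (cubeCode rightNumber j n A))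
    .id (computable_spectraMeet
      (hf₁.comp (primrec_cubeCode (primrec_number 0) (.const 0) .fst .snd).to_comp)
      (hg₂.comp (hc (.const 0) (Primrec.fst.comp .fst) (Primrec.snd.comp .fst)).to_comp .snd)
      (hf₂.comp (hc .snd (Primrec.fst.comp .fst) (Primrec.snd.comp .fst)).to_comp))
  refine ⟨f, hf, fun φ hφ => ?_⟩
  rw [H]
  have key (A : List ℕ) : ∃ (Ψ₁ : L₁.Formula ℕ) (Ψ₂ : L₂.Formula ℕ),
      (∀ (M : Type) [L₁.Structure M] (w : ℕ → M),
        Ψ₁.Realize w ↔ Diagram (LHom.sumInl : L₁ →ᴸ L₁.sum L₂) (code φ) A M w) ∧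
      (∀ (M : Type) [L₂.Structure M] (w : ℕ → M),
        Ψ₂.Realize w ↔ Diagram (LHom.sumInr : L₂ →ᴸ L₁.sum L₂) (code φ) A M w) ∧
      (spectraMeet (f₁ (cubeCode leftNumber 0 (code φ) A))
        (fun k => g₂ (cubeCode rightNumber 0 (code φ) A) k)
        (fun j => f₂ (cubeCode rightNumber j (code φ) A)) = true ↔
        (Spec T₁ Ψ₁ ∩ Spec T₂ Ψ₂).Nonempty) := by
    obtain ⟨Ψ₁, c₁, e₁, r₁⟩ := exists_cube_of_guess (isTranslation_left (L₂ := L₂)) hφ A 0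
    obtain ⟨Ψ₂, c₂, e₂, r₂⟩ := exists_cube_of_guess (isTranslation_right (L₁ := L₁)) hφ A 0
    have r₂' : ∀ (M : Type) [L₂.Structure M] (w : ℕ → M),
        Ψ₂.Realize w ↔ Diagram (LHom.sumInr : L₂ →ᴸ L₁.sum L₂) (code φ) A M w :=
      fun M _ w => by simpa using r₂ M w
    refine ⟨Ψ₁, Ψ₂, fun M _ w => by simpa using r₁ M w, r₂', ?_⟩
    obtain ⟨s₁, s₂, s₃⟩ := H₁ Ψ₁ c₁
    rw [e₁] at s₁ s₂ s₃
    refine spectraMeet_iff s₁ s₂ s₃ (fun k hk => e₂ ▸ G₂ Ψ₂ c₂.isQF k hk) (fun j => ?_)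
      fun κ hκ => ⟨Spec.pos hκ, hκ.1⟩
    -- With `j` distinct fresh variables, `T₂`-satisfiability says exactly that the spectrum of `Ψ₂`
    -- has an element `≥ j`.
    obtain ⟨Ψ, c, e, r⟩ := exists_cube_of_guess (isTranslation_right (L₁ := L₁)) hφ A j
    rw [← e, H₂ Ψ c.isQF]
    exact satisfiable_cube_iff hφ r₂' r
  constructor
  · rintro ⟨A, -, hA, h⟩
    obtain ⟨Ψ₁, Ψ₂, r₁, r₂, hiff⟩ := key A
    obtain ⟨κ, ⟨-, M₁, _, w₁, m₁, d₁, rfl⟩, -, M₂, _, w₂, m₂, d₂, hM⟩ := hiff.1 h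
    exact satisfiable_combine_of_diagrams hφ hA m₁ m₂ hM ((r₁ M₁ w₁).1 d₁) ((r₂ M₂ w₂).1 d₂)
  · intro h
    obtain ⟨A, hA, hc, M, _, _, w, hM, m₁, m₂, d₁, d₂⟩ := exists_diagrams_of_satisfiable hφ h
    obtain ⟨Ψ₁, Ψ₂, r₁, r₂, hiff⟩ := key A
    exact ⟨A, hA, hc, hiff.2 ⟨#M, ⟨hM, M, _, w, m₁, (r₁ M w).2 d₁, rfl⟩,
      ⟨hM, M, _, w, m₂, (r₂ M w).2 d₂, rfl⟩⟩⟩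

/-! ### Computable finite spectra from spectra of cubes -/

section FiniteSpectra
variable {L : FirstOrder.Language.{0, 0}} [Encodable (Σ n, L.Functions n)]
  [Encodable (Σ n, L.Relations n)] {T : L.Theory}

/-- The spectrum of a quantifier-free formula is the union, over its finitely many consistent
guesses, of the spectra of their cubes. -/
theorem hasComputableFiniteSpectra_of_cubes {g : ℕ → ℕ → Bool} (hg : Computable₂ g)
    (G : ∀ φ : L.Formula ℕ, IsCube φ → ∀ k : ℕ, 0 < k →
      (g (code φ) k = true ↔ (k : Cardinal) ∈ Spec T φ)) :
    HasComputableFiniteSpectra T := by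
  obtain ⟨f, hf, H⟩ := computable_exists_guess (n := fun x : ℕ × ℕ => x.1)
    (test := fun x A => g (cubeCode some 0 x.1 A) x.2) .fst
    (hg.comp (primrec_cubeCode .option_some (.const 0) (Primrec.fst.comp .fst) .snd).to_comp
      (Computable.snd.comp .fst))
  refine ⟨fun n k => f (n, k), hf, fun φ hφ k hk => ?_⟩
  rw [H]
  constructor
  · rintro ⟨A, -, hA, h⟩
    obtain ⟨Ψ, c, e, r⟩ := exists_cube_of_guess isTranslation_id hφ A 0
    rw [← e, G Ψ c k hk] at h
    obtain ⟨hκ, M, _, w, hT, hw, hM⟩ := h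
    obtain ⟨v, hv⟩ := realize_of_diagram hφ hA ((r M w).1 hw).1
    exact ⟨hκ, M, _, v, hT, hv, hM⟩
  · rintro ⟨hκ, M, _, v, hT, hv, hM⟩
    obtain ⟨A, hA, hc, w, d⟩ := exists_diagram_of_realize hφ hv
    obtain ⟨Ψ, c, e, r⟩ := exists_cube_of_guess isTranslation_id hφ A 0
    refine ⟨A, hA, hc, ?_⟩
    rw [← e, G Ψ c k hk]
    exact ⟨hκ, M, _, w, hT, (r M w).2 ⟨d, by simp⟩, hM⟩

theorem IsGentle.hasComputableFiniteSpectra (h : IsGentle T) : HasComputableFiniteSpectra T := by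
  obtain ⟨f, hf, H⟩ := h
  refine hasComputableFiniteSpectra_of_cubes (g := fun c k =>
    bif (f c).1 then decide (k ∈ (f c).2) else !decide (k ∈ (f c).2)) ?_ fun φ hφ k hk => ?_
  · have hfc : Computable fun x : ℕ × ℕ => f x.1 := hf.comp .fst
    have hmem : Computable fun x : ℕ × ℕ => decide (x.2 ∈ (f x.1).2) :=
      primrecRel_mem.decide.to_comp.comp .snd (Computable.snd.comp hfc)
    exact Computable.cond (Computable.fst.comp hfc) hmem (Primrec.not.to_comp.comp hmem)
  · obtain ⟨-, h₁, h₂⟩ := H φ hφ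
    cases hb : (f (code φ)).1 with
    | true => simp [h₁ hb]
    | false =>
      simp only [h₂ hb, cond_false, Bool.not_eq_true', decide_eq_false_iff_not, Set.mem_ofPred_eq,
        Nat.cast_pos, hk, Cardinal.natCast_le_aleph0, Nat.cast_inj, true_and]
      exact ⟨fun h ⟨x, hx, e⟩ => h (e ▸ hx), fun h hk => h ⟨k, hk, rfl⟩⟩

theorem HasComputableSpectraAsFiniteSets.hasComputableFiniteSpectra
    (h : HasComputableSpectraAsFiniteSets T) : HasComputableFiniteSpectra T := by
  obtain ⟨f, hf, H⟩ := h
  refine hasComputableFiniteSpectra_of_cubes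
    (g := fun c k => decide (some k ∈ f c)) ?_ fun φ hφ k hk => ?_
  · exact primrecRel_mem.decide.to_comp.comp (Computable.option_some.comp .snd) (hf.comp .fst)
  · simp [H φ hφ, Cardinal.natCast_lt_aleph0.ne]

end FiniteSpectra

/-! ### Finite structures given by tables -/

/-- An entry to be looked up in a table: a kind (`0` for a variable, `1` for a function symbol,
`2` for a predicate symbol), the number of the variable or symbol, and the arguments. -/
abbrev Key := ℕ × ℕ × List ℕ

/-- A finite table of values. -/
abbrev Table := List (Key × ℕ)

/-- The value of a key in a table, by default `0`. -/
def Table.value (τ : Table) (x : Key) : ℕ := (@List.lookup Key ℕ instBEqOfDecidableEq x τ).getD 0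

/-- The structure on `Fin (k + 1)` given by a table. -/
@[reducible]
def tableStructure (L : FirstOrder.Language.{0, 0}) [Encodable (Σ n, L.Functions n)]
    [Encodable (Σ n, L.Relations n)] (k : ℕ) (τ : Table) : L.Structure (Fin (k + 1)) where
  funMap {n} f x := Fin.ofNat (k + 1) (τ.value
    (1, Encodable.encode (⟨n, f⟩ : Σ n, L.Functions n), List.ofFn fun i => (x i).val))
  RelMap {n} R x := τ.value
    (2, Encodable.encode (⟨n, R⟩ : Σ n, L.Relations n), List.ofFn fun i => (x i).val) = 0

/-- The value of a variable in a table. -/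
def varValue (k : ℕ) (τ : Table) (s : ℕ) : ℕ := τ.value (0, s, []) % (k + 1)

/-- The assignment given by a table. -/
def tableAssignment (k : ℕ) (τ : Table) (s : ℕ) : Fin (k + 1) :=
  Fin.ofNat (k + 1) (τ.value (0, s, []))

/-- The lists of given length of numbers `≤ k`. -/
def tuples (k len : ℕ) : List (List ℕ) :=
  (fun ls => ls.flatMap fun l => (List.range (k + 1)).map fun a => a :: l)^[len] [ [] ]

/-- The keys for a list of symbols, each given by its kind, number and arity. -/
def keys (k : ℕ) (S : List (ℕ × ℕ × ℕ)) : List Key :=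
  S.flatMap fun s => (tuples k s.2.2).map fun l => (s.1, s.2.1, l)

/-- All tables with the given keys and values `≤ k + 1`. -/
def tables (k : ℕ) (K : List Key) : List Table :=
  K.foldr (fun x ts => ts.flatMap fun τ => (List.range (k + 2)).map fun v => (x, v) :: τ) [ [] ]

theorem mem_tuples {k : ℕ} {l : List ℕ} (h : ∀ a ∈ l, a ≤ k) : l ∈ tuples k l.length := by
  induction l with
  | nil => exact List.mem_singleton_self _
  | cons a l ih =>
    rw [tuples, List.length_cons, Function.iterate_succ_apply', ← tuples]
    refine List.mem_flatMap.2 ⟨l, ih fun b hb => h b (List.mem_cons_of_mem _ hb),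
      List.mem_map.2 ⟨a, List.mem_range.2 ?_, rfl⟩⟩
    exact Nat.lt_succ_of_le (h a List.mem_cons_self)

theorem mem_keys {k : ℕ} {S : List (ℕ × ℕ × ℕ)} {i e n : ℕ} (h : (i, e, n) ∈ S)
    (x : Fin n → Fin (k + 1)) : (i, e, List.ofFn fun j => (x j).val) ∈ keys k S := by
  refine List.mem_flatMap.2 ⟨_, h, List.mem_map.2 ⟨_, ?_, rfl⟩⟩
  have := mem_tuples (k := k) (l := List.ofFn fun j => (x j).val) (by
    simp only [List.mem_ofFn]
    rintro _ ⟨j, rfl⟩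
    exact Nat.le_of_lt_succ (x j).2)
  rwa [List.length_ofFn] at this

theorem mem_tables {k : ℕ} {g : Key → ℕ} (hg : ∀ x, g x ≤ k + 1) (K : List Key) :
    K.map (fun x => (x, g x)) ∈ tables k K := by
  induction K with
  | nil => exact List.mem_singleton_self _
  | cons x K ih =>
    exact List.mem_flatMap.2 ⟨_, ih, List.mem_map.2
      ⟨g x, List.mem_range.2 (Nat.lt_succ_of_le (hg x)), rfl⟩⟩

/-- Repeated keys are harmless, since all their entries carry the same value. -/
theorem value_map {g : Key → ℕ} {K : List Key} {x : Key} (hx : x ∈ K) :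
    Table.value (K.map fun y => (y, g y)) x = g x := by
  induction K with
  | nil => simp at hx
  | cons y K ih =>
    by_cases h : x = y
    · subst h
      simp [Table.value]
    · have := ih ((List.mem_cons.1 hx).resolve_left h)
      simp only [Table.value, List.map_cons, List.lookup] at this ⊢
      split
      · rename_i hxy
        exact absurd (eq_of_beq hxy) h
      · exact this

/-! ### Agreement of structures on finitely many symbols. -/

section Structures
variable {L : FirstOrder.Language.{0, 0}} [Encodable (Σ n, L.Functions n)]
  [Encodable (Σ n, L.Relations n)]

/-- Two structures agree on a list of symbols. -/
structure AgreeOn (S : List (ℕ × ℕ × ℕ)) {M : Type} (s₁ s₂ : L.Structure M) : Prop where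
  func : ∀ {n : ℕ} (f : L.Functions n),
    (1, Encodable.encode (⟨n, f⟩ : Σ n, L.Functions n), n) ∈ S →
      ∀ x, s₁.funMap f x = s₂.funMap f x
  rel : ∀ {n : ℕ} (R : L.Relations n),
    (2, Encodable.encode (⟨n, R⟩ : Σ n, L.Relations n), n) ∈ S →
      ∀ x, (s₁.RelMap R x ↔ s₂.RelMap R x)

theorem AgreeOn.mono {S S' : List (ℕ × ℕ × ℕ)} {M : Type} {s₁ s₂ : L.Structure M}
    (h : AgreeOn S s₁ s₂) (hS : S' ⊆ S) : AgreeOn S' s₁ s₂ :=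
  ⟨fun f hf => h.func f (hS hf), fun R hR => h.rel R (hS hR)⟩

/-- Every structure on `Fin (k + 1)` with an assignment agrees with that of a table on any given
list of symbols and variables. -/
theorem exists_table (k : ℕ) (S : List (ℕ × ℕ × ℕ)) (s : L.Structure (Fin (k + 1)))
    (w : ℕ → Fin (k + 1)) : ∃ τ ∈ tables k (keys k S), AgreeOn S (tableStructure L k τ) s ∧
      ∀ i, (0, i, 0) ∈ S → tableAssignment k τ i = w i := by
  classical
  let func : ℕ → List ℕ → Fin (k + 1) → Prop := fun e l y =>
    ∃ (n : ℕ) (f : L.Functions n) (x : Fin n → Fin (k + 1)),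
      e = Encodable.encode (⟨n, f⟩ : Σ n, L.Functions n) ∧
      (l = List.ofFn fun i => (x i).val) ∧ y = s.funMap f x
  let rel : ℕ → List ℕ → Prop := fun e l =>
    ∃ (n : ℕ) (R : L.Relations n) (x : Fin n → Fin (k + 1)),
      e = Encodable.encode (⟨n, R⟩ : Σ n, L.Relations n) ∧
      (l = List.ofFn fun i => (x i).val) ∧ s.RelMap R x
  let g : Key → ℕ := fun z =>
    if z.1 = 0 then w z.2.1
    else if z.1 = 1 then if h : ∃ y, func z.2.1 z.2.2 y then h.choose.val else 0
    else if rel z.2.1 z.2.2 then 0 else 1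
  -- A false predicate is recorded as `1`, which exceeds `k` when `k = 0`; hence the bound `k + 1`.
  have hg (z : Key) : g z ≤ k + 1 := by
    simp only [g]
    split_ifs with _ _ h
    exacts [(w z.2.1).2.le, h.choose.2.le, by omega, by omega, by omega]
  have ofFn_inj {n : ℕ} {x y : Fin n → Fin (k + 1)}
      (h : (List.ofFn fun i => (x i).val) = List.ofFn fun i => (y i).val) : x = y :=
    funext fun i => Fin.ext (congrFun (List.ofFn_injective h) i)
  have ofNat_val (y : Fin (k + 1)) : Fin.ofNat (k + 1) y.val = y := Fin.ofNat_val_eq_self y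
  refine ⟨_, mem_tables hg (keys k S), ⟨fun {n} f hf x => ?_, fun {n} R hR x => ?_⟩,
    fun i hi => ?_⟩
  · have hy : ∃ y, func (Encodable.encode (⟨n, f⟩ : Σ n, L.Functions n))
        (List.ofFn fun i => (x i).val) y := ⟨_, n, f, x, rfl, rfl, rfl⟩
    change Fin.ofNat (k + 1) (Table.value _ _) = _
    rw [value_map (mem_keys hf x)]
    simp only [g, one_ne_zero, if_false, if_true, dif_pos hy, ofNat_val]
    obtain ⟨n', f', x', h₁, h₂, h₃⟩ := hy.choose_spec
    rw [h₃]
    cases Encodable.encode_injective h₁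
    rw [ofFn_inj h₂]
  · change Table.value _ _ = 0 ↔ _
    rw [value_map (mem_keys hR x)]
    simp only [g, OfNat.ofNat_ne_zero, OfNat.ofNat_ne_one, if_false, ite_eq_left_iff, one_ne_zero,
      imp_false, not_not]
    constructor
    · rintro ⟨n', R', x', h₁, h₂, h₃⟩
      cases Encodable.encode_injective h₁
      rwa [ofFn_inj h₂]
    · exact fun h => ⟨n, R, x, rfl, rfl, h⟩
  -- A variable is looked up as a symbol of arity `0`, with an empty argument list.
  · have := value_map (g := g) (mem_keys hi (k := k) Fin.elim0)
    rw [List.ofFn_zero] at this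
    rw [tableAssignment, this]
    simp only [g, if_true, ofNat_val]

/-! ### Evaluation of a fixed sentence -/

theorem exists_symbols_term {α : Type} (t : L.Term α) : ∃ S, ∀ (M : Type) (s₁ s₂ : L.Structure M),
    AgreeOn S s₁ s₂ → ∀ v : α → M, @Term.realize L M s₁ _ v t = @Term.realize L M s₂ _ v t := by
  induction t with
  | var x => exact ⟨[], fun _ _ _ _ _ => rfl⟩
  | @func l f ts ih =>
    choose S hS using ih
    refine ⟨(1, Encodable.encode (⟨l, f⟩ : Σ n, L.Functions n), l) :: (List.ofFn S).flatten,
      fun M s₁ s₂ h v => ?_⟩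
    simp only [Term.realize]
    rw [h.func f List.mem_cons_self]
    congr 1
    funext i
    refine hS i M s₁ s₂ (h.mono fun x hx => List.mem_cons_of_mem _ ?_) v
    exact List.mem_flatten.2 ⟨S i, List.mem_ofFn.2 ⟨i, rfl⟩, hx⟩

/-- Only finitely many symbols occur in `ψ`, so a finite table can determine its truth value. -/
theorem exists_symbols_formula {α : Type} {m : ℕ} (ψ : L.BoundedFormula α m) :
    ∃ S, ∀ (M : Type) (s₁ s₂ : L.Structure M), AgreeOn S s₁ s₂ → ∀ (v : α → M) (x : Fin m → M),
      (@BoundedFormula.Realize L M s₁ _ _ ψ v x ↔ @BoundedFormula.Realize L M s₂ _ _ ψ v x) := by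
  induction ψ with
  | falsum => exact ⟨[], fun _ _ _ _ _ _ => Iff.rfl⟩
  | equal t u =>
    obtain ⟨S, hS⟩ := exists_symbols_term t
    obtain ⟨S', hS'⟩ := exists_symbols_term u
    refine ⟨S ++ S', fun M s₁ s₂ h v x => ?_⟩
    simp only [BoundedFormula.Realize, hS M s₁ s₂ (h.mono (List.subset_append_left _ _)),
      hS' M s₁ s₂ (h.mono (List.subset_append_right _ _))]
  | @rel _ l R ts =>
    choose S hS using fun i => exists_symbols_term (ts i)
    refine ⟨(2, Encodable.encode (⟨l, R⟩ : Σ n, L.Relations n), l) :: (List.ofFn S).flatten,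
      fun M s₁ s₂ h v x => ?_⟩
    simp only [BoundedFormula.Realize]
    rw [h.rel R List.mem_cons_self]
    have (i : Fin l) := hS i M s₁ s₂ (h.mono fun y hy => List.mem_cons_of_mem _
      (List.mem_flatten.2 ⟨S i, List.mem_ofFn.2 ⟨i, rfl⟩, hy⟩)) (Sum.elim v x)
    simp only [this]
  | imp _ _ ih₁ ih₂ =>
    obtain ⟨S, hS⟩ := ih₁
    obtain ⟨S', hS'⟩ := ih₂
    refine ⟨S ++ S', fun M s₁ s₂ h v x => ?_⟩
    simp only [BoundedFormula.Realize, hS M s₁ s₂ (h.mono (List.subset_append_left _ _)),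
      hS' M s₁ s₂ (h.mono (List.subset_append_right _ _))]
  | all _ ih =>
    obtain ⟨S, hS⟩ := ih
    refine ⟨S, fun M s₁ s₂ h v x => ?_⟩
    simp only [BoundedFormula.Realize, hS M s₁ s₂ h]

theorem primrec_value : Primrec₂ Table.value :=
  Primrec.option_getD.comp (Primrec.listLookup.comp .snd .fst) (.const 0)

theorem primrec_eval_term {m : ℕ} (t : L.Term (Empty ⊕ Fin m)) :
    ∃ g : (ℕ × Table) × List ℕ → ℕ, Primrec g ∧
      ∀ (k : ℕ) (τ : Table) (x : Fin m → Fin (k + 1)),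
        g ((k, τ), List.ofFn fun i => (x i).val) =
          (@Term.realize L _ (tableStructure L k τ) _ (Sum.elim default x) t).val := by
  induction t with
  | var i =>
    rcases i with i | i
    · exact i.elim
    · refine ⟨fun p => p.2.getD i 0, (Primrec.list_getD 0).comp .snd (.const _),
        fun k τ x => ?_⟩
      simp [Term.realize]
  | @func l f ts ih =>
    choose g hg hgv using ih
    refine ⟨fun p => p.1.2.value (1, Encodable.encode (⟨l, f⟩ : Σ n, L.Functions n),
      List.ofFn fun i => g i p) % (p.1.1 + 1), ?_, fun k τ x => ?_⟩
    · refine Primrec.nat_mod.comp (primrec_value.comp (Primrec.snd.comp .fst) ?_)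
        (Primrec.succ.comp (Primrec.fst.comp .fst))
      exact .pair (.const _) (.pair (.const _) (Primrec.list_ofFn hg))
    · simp only [hgv]
      rfl

/-- Since `ψ` is fixed, the recursion on its syntax builds the algorithm and is not carried out by
it. Quantifiers become bounded searches, with the value of each new bound variable appended to the
list. -/
theorem primrec_eval_formula {m : ℕ} (ψ : L.BoundedFormula Empty m) :
    ∃ P : (ℕ × Table) × List ℕ → Prop, PrimrecPred P ∧
      ∀ (k : ℕ) (τ : Table) (x : Fin m → Fin (k + 1)),
        P ((k, τ), List.ofFn fun i => (x i).val) ↔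
          @BoundedFormula.Realize L _ (tableStructure L k τ) _ _ ψ default x := by
  induction ψ with
  | falsum => exact ⟨fun _ => False, ⟨inferInstance, .const _⟩, fun _ _ _ => Iff.rfl⟩
  | equal t u =>
    obtain ⟨g, hg, hgv⟩ := primrec_eval_term t
    obtain ⟨g', hg', hgv'⟩ := primrec_eval_term u
    refine ⟨fun p => g p = g' p, Primrec.eq.comp hg hg', fun k τ x => ?_⟩
    change g _ = g' _ ↔ _
    rw [hgv, hgv', ← Fin.ext_iff]
    rfl
  | @rel _ l R ts =>
    choose g hg hgv using fun i => primrec_eval_term (ts i)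
    refine ⟨fun p => p.1.2.value (2, Encodable.encode (⟨l, R⟩ : Σ n, L.Relations n),
      List.ofFn fun i => g i p) = 0, Primrec.eq.comp (primrec_value.comp
        (Primrec.snd.comp .fst) ?_) (.const 0), fun k τ x => ?_⟩
    · exact .pair (.const _) (.pair (.const _) (Primrec.list_ofFn hg))
    · simp only [hgv]
      rfl
  | imp _ _ ih₁ ih₂ =>
    obtain ⟨P, hP, hPv⟩ := ih₁
    obtain ⟨Q, hQ, hQv⟩ := ih₂
    refine ⟨fun p => ¬ P p ∨ Q p, hP.not.or hQ, fun k τ x => ?_⟩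
    change ¬ P _ ∨ Q _ ↔ _
    rw [hPv, hQv, ← imp_iff_not_or]
    rfl
  | @all m _ ih =>
    obtain ⟨P, hP, hPv⟩ := ih
    refine ⟨fun p => ∀ a < p.1.1 + 1, P (p.1, p.2 ++ [a]), ?_, fun k τ x => ?_⟩
    · have h : PrimrecRel fun (a : ℕ) (p : (ℕ × Table) × List ℕ) => P (p.1, p.2 ++ [a]) :=
        hP.comp (.pair (Primrec.fst.comp .snd)
          (Primrec.list_concat.comp (Primrec.snd.comp .snd) .fst))
      exact (primrecPred_forall_mem (Primrec.list_range.comp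
        (Primrec.succ.comp (Primrec.fst.comp .fst))) h).of_eq fun p => by simp
    · have hsnoc (a : Fin (k + 1)) : (List.ofFn fun i => (x i).val) ++ [a.val] =
          List.ofFn fun i => ((Fin.snoc x a : Fin (m + 1) → Fin (k + 1)) i).val := by
        rw [List.ofFn_succ', List.concat_eq_append]
        simp
      simp only [BoundedFormula.Realize, ← hPv, ← hsnoc]
      exact ⟨fun h a => h a a.2, fun h a ha => h ⟨a, ha⟩⟩

theorem exists_symbols_theory {A : L.Theory} (hA : A.Finite) :
    ∃ S, ∀ (M : Type) (s₁ s₂ : L.Structure M), AgreeOn S s₁ s₂ →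
      (@Theory.Model L M s₁ A ↔ @Theory.Model L M s₂ A) := by
  induction A, hA using Set.Finite.induction_on with
  | empty => exact ⟨[], fun M s₁ s₂ _ => by simp [Theory.model_iff]⟩
  | @insert ψ A _ _ ih =>
    obtain ⟨S, hS⟩ := ih
    obtain ⟨S', hS'⟩ := exists_symbols_formula ψ
    refine ⟨S ++ S', fun M s₁ s₂ h => ?_⟩
    have h₁ := hS M s₁ s₂ (h.mono (List.subset_append_left _ _))
    have h₂ := hS' M s₁ s₂ (h.mono (List.subset_append_right _ _)) default default
    simp only [Theory.model_iff, Set.forall_mem_insert] at h₁ ⊢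
    exact and_congr h₂ h₁

theorem primrec_eval_theory {A : L.Theory} (hA : A.Finite) :
    ∃ P : ℕ × Table → Prop, PrimrecPred P ∧
      ∀ k τ, P (k, τ) ↔ @Theory.Model L _ (tableStructure L k τ) A := by
  induction A, hA using Set.Finite.induction_on with
  | empty => exact ⟨fun _ => True, ⟨inferInstance, .const _⟩, fun k τ => by simp [Theory.model_iff]⟩
  | @insert ψ A _ _ ih =>
    obtain ⟨P, hP, hPv⟩ := ih
    obtain ⟨Q, hQ, hQv⟩ := primrec_eval_formula ψ
    refine ⟨fun p => Q (p, []) ∧ P p, (hQ.comp (.pair .id (.const []))).and hP, fun k τ => ?_⟩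
    have h := hQv k τ default
    rw [List.ofFn_zero] at h
    simp only [hPv, h, Theory.model_iff, Set.forall_mem_insert]
    refine and_congr (iff_of_eq ?_) Iff.rfl
    exact congrArg₂ (fun v x => @BoundedFormula.Realize L _ (tableStructure L k τ) _ _ ψ v x)
      (Subsingleton.elim _ _) (Subsingleton.elim _ _)

end Structures

/-! ### Finitely axiomatizable theories -/

/-- The symbols, and the variables standing for subterms, in the formula with code `n`. -/
def symbols (n : ℕ) : List (ℕ × ℕ × ℕ) :=
  (termNodes n).map (fun s => (0, s, 0)) ++
    (((termNodes n).filter fun m => tag m = 2).map fun m => (1, lhs m, (args m).length)) ++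
    ((formulaNodes n).filter fun m => tag m = 2).map fun m => (2, lhs m, (args m).length)

/-- The facts that the guess `A` asserts hold in the structure given by a table. -/
def TableDiagram (k : ℕ) (τ : Table) (n : ℕ) (A : List ℕ) : Prop :=
  (∀ s ∈ termNodes n, ∀ t ∈ termNodes n, (varValue k τ s = varValue k τ t ↔ equalCode s t ∈ A)) ∧
  (∀ m ∈ (termNodes n).filter fun m => tag m = 2, varValue k τ m =
    τ.value (1, lhs m, (args m).map (varValue k τ)) % (k + 1)) ∧
  (∀ m ∈ (formulaNodes n).filter fun m => tag m = 2,
    (τ.value (2, lhs m, (args m).map (varValue k τ)) = 0 ↔ m ∈ A))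

/-! ### Computability of the search through tables. -/

theorem primrec_symbols : Primrec symbols := by
  have h (i : ℕ) : Primrec fun l : List ℕ =>
      (l.filter fun m => tag m = 2).map fun m => (i, lhs m, (args m).length) :=
    Primrec.list_map primrec_tag_filter <| Primrec.pair (.const i) <|
      .pair (primrec_lhs.comp .snd) (Primrec.list_length.comp (primrec_args.comp .snd))
  refine Primrec.list_append.comp (Primrec.list_append.comp ?_ ((h 1).comp primrec_termNodes))
    ((h 2).comp primrec_formulaNodes)
  exact Primrec.list_map primrec_termNodes (Primrec.pair (.const 0) (.pair .snd (.const 0)))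

theorem primrec_varValue {α : Type} [Primcodable α] {k s : α → ℕ} {τ : α → Table}
    (hk : Primrec k) (hτ : Primrec τ) (hs : Primrec s) :
    Primrec fun a => varValue (k a) (τ a) (s a) :=
  Primrec.nat_mod.comp (primrec_value.comp hτ (.pair (.const 0) (.pair hs (.const []))))
    (Primrec.succ.comp hk)

theorem primrecPred_iff {α : Type} [Primcodable α] {p q : α → Prop} (hp : PrimrecPred p)
    (hq : PrimrecPred q) : PrimrecPred fun a => p a ↔ q a :=
  ((hp.not.or hq).and (hq.not.or hp)).of_eq fun a => by tauto

theorem primrecPred_tableDiagram : PrimrecPred fun x : (ℕ × Table) × ℕ × List ℕ =>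
    TableDiagram x.1.1 x.1.2 x.2.1 x.2.2 := by
  have hkey {β : Type} [Primcodable β] (i : ℕ) {m : β → ℕ} {x : β → (ℕ × Table) × ℕ × List ℕ}
      (hm : Primrec m) (hx : Primrec x) : Primrec fun b =>
        (x b).1.2.value (i, lhs (m b), (args (m b)).map (varValue (x b).1.1 (x b).1.2)) := by
    refine primrec_value.comp (Primrec.snd.comp (Primrec.fst.comp hx))
      (.pair (.const i) (.pair (primrec_lhs.comp hm) ?_))
    refine Primrec.list_map (primrec_args.comp hm) ?_
    have hx' : Primrec fun y : β × ℕ => (x y.1).1 := Primrec.fst.comp (hx.comp .fst)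
    exact primrec_varValue (Primrec.fst.comp hx') (Primrec.snd.comp hx') .snd
  have hn : Primrec fun x : (ℕ × Table) × ℕ × List ℕ => x.2.1 := Primrec.fst.comp .snd
  refine (PrimrecPred.and ?_ (PrimrecPred.and ?_ ?_))
  · refine primrecPred_forall_mem (R := fun s (x : (ℕ × Table) × ℕ × List ℕ) =>
      ∀ t ∈ termNodes x.2.1, (varValue x.1.1 x.1.2 s = varValue x.1.1 x.1.2 t ↔
        equalCode s t ∈ x.2.2)) (primrec_termNodes.comp hn) ?_
    refine primrecPred_forall_mem (R := fun t (y : ℕ × (ℕ × Table) × ℕ × List ℕ) =>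
      varValue y.2.1.1 y.2.1.2 y.1 = varValue y.2.1.1 y.2.1.2 t ↔ equalCode y.1 t ∈ y.2.2.2)
      (primrec_termNodes.comp (hn.comp .snd)) ?_
    have hx : Primrec fun z : ℕ × ℕ × (ℕ × Table) × ℕ × List ℕ => z.2.2 := Primrec.snd.comp .snd
    have hk := Primrec.fst.comp (Primrec.fst.comp hx)
    have hτ := Primrec.snd.comp (Primrec.fst.comp hx)
    have hs : Primrec fun z : ℕ × ℕ × (ℕ × Table) × ℕ × List ℕ => z.2.1 := Primrec.fst.comp .snd
    exact primrecPred_iff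
      (Primrec.eq.comp (primrec_varValue hk hτ hs) (primrec_varValue hk hτ .fst))
      (primrecRel_mem.comp (primrec_equalCode.comp hs .fst)
        (Primrec.snd.comp (Primrec.snd.comp hx)))
  · refine primrecPred_forall_mem (R := fun m (x : (ℕ × Table) × ℕ × List ℕ) =>
      varValue x.1.1 x.1.2 m =
        x.1.2.value (1, lhs m, (args m).map (varValue x.1.1 x.1.2)) % (x.1.1 + 1))
      (primrec_tag_filter.comp (primrec_termNodes.comp hn)) ?_
    have hk : Primrec fun z : ℕ × (ℕ × Table) × ℕ × List ℕ => z.2.1.1 :=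
      Primrec.fst.comp (Primrec.fst.comp .snd)
    exact Primrec.eq.comp
      (primrec_varValue hk (Primrec.snd.comp (Primrec.fst.comp .snd)) .fst)
      (Primrec.nat_mod.comp (hkey 1 .fst .snd) (Primrec.succ.comp hk))
  · refine primrecPred_forall_mem (R := fun m (x : (ℕ × Table) × ℕ × List ℕ) =>
      x.1.2.value (2, lhs m, (args m).map (varValue x.1.1 x.1.2)) = 0 ↔ m ∈ x.2.2)
      (primrec_tag_filter.comp (primrec_formulaNodes.comp hn)) ?_
    exact primrecPred_iff (Primrec.eq.comp (hkey 2 .fst .snd) (.const 0))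
      (primrecRel_mem.comp .fst (Primrec.snd.comp (Primrec.snd.comp .snd)))

theorem primrec_tuples : Primrec₂ tuples := by
  refine Primrec.nat_iterate (f := fun p : ℕ × ℕ => p.2) (g := fun _ => [ [] ])
    (h := fun p ls => ls.flatMap fun l => (List.range (p.1 + 1)).map fun a => a :: l)
    .snd (.const _) ?_
  refine Primrec.list_flatMap .snd (Primrec.list_map (Primrec.list_range.comp
    (Primrec.succ.comp (Primrec.fst.comp (Primrec.fst.comp .fst)))) ?_)
  exact Primrec.list_cons.comp .snd (Primrec.snd.comp .fst)

theorem primrec_keys : Primrec₂ keys := by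
  refine Primrec.list_flatMap .snd (Primrec.list_map (primrec_tuples.comp
    (Primrec.fst.comp .fst) (Primrec.snd.comp (Primrec.snd.comp .snd))) ?_)
  have hs : Primrec fun x : ((ℕ × List (ℕ × ℕ × ℕ)) × ℕ × ℕ × ℕ) × List ℕ => x.1.2 :=
    Primrec.snd.comp .fst
  exact Primrec.pair (Primrec.fst.comp hs) (.pair (Primrec.fst.comp (Primrec.snd.comp hs)) .snd)

theorem primrec_tables : Primrec₂ tables := by
  refine Primrec.list_foldr (f := fun p : ℕ × List Key => p.2) (g := fun _ => [ [] ])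
    (h := fun p (y : Key × List Table) =>
      y.2.flatMap fun τ => (List.range (p.1 + 2)).map fun v => (y.1, v) :: τ) .snd (.const _) ?_
  refine Primrec.list_flatMap (Primrec.snd.comp .snd) (Primrec.list_map (Primrec.list_range.comp
    (Primrec.succ.comp (Primrec.succ.comp (Primrec.fst.comp (Primrec.fst.comp .fst))))) ?_)
  exact Primrec.list_cons.comp
    (.pair (Primrec.fst.comp (Primrec.snd.comp (Primrec.fst.comp .fst))) .snd)
    (Primrec.snd.comp .fst)

section
variable {L : FirstOrder.Language.{0, 0}} [Encodable (Σ n, L.Functions n)]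
  [Encodable (Σ n, L.Relations n)]

theorem tableDiagram_iff {φ : L.Formula ℕ} (hφ : BoundedFormula.IsQF φ) {k : ℕ} {τ : Table}
    {A : List ℕ} : TableDiagram k τ (code φ) A ↔
      @Diagram _ _ _ _ (LHom.id L) (code φ) A _ (tableStructure L k τ) (tableAssignment k τ) := by
  let _ := tableStructure L k τ
  have hmap {l : ℕ} (ts : Fin l → L.Term (ℕ ⊕ Fin 0)) :
      (List.ofFn fun i => termCode (ts i)).map (varValue k τ) =
        List.ofFn fun i => (tableAssignment k τ (termCode (ts i))).val := by
    rw [List.map_ofFn]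
    rfl
  constructor
  · rintro ⟨h₁, h₂, h₃⟩
    refine ⟨fun s hs t ht => Fin.ext_iff.trans (h₁ s hs t ht), fun l f ts hm => Fin.ext ?_,
      fun l R ts hm => ?_⟩
    · have := h₂ _ (List.mem_filter.2 ⟨hm, by simp [termCode]⟩)
      refine this.trans ?_
      simp only [termCode, lhs_pair, args_pair, hmap]
      rfl
    · rw [← h₃ _ (List.mem_filter.2 ⟨hm, by simp [code]⟩)]
      simp only [code, lhs_pair, args_pair, hmap]
      rfl
  · intro h
    refine ⟨fun s hs t ht => Fin.ext_iff.symm.trans (h.equal s hs t ht), fun m hm => ?_,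
      fun m hm => ?_⟩ <;> obtain ⟨hm, h₂⟩ := List.mem_filter.1 hm
    · obtain ⟨t, rfl⟩ := exists_term_of_mem hφ hm
      cases t with
      | var x => rcases x with x | x <;> simp [termCode] at h₂
      | func f ts =>
        refine (Fin.ext_iff.1 (h.func _ f ts hm)).trans ?_
        simp only [termCode, lhs_pair, args_pair, hmap]
        rfl
    · obtain ⟨ψ, hψ, rfl⟩ := exists_formula_of_mem hφ hm
      cases hψ with
      | falsum => simp [code] at h₂
      | imp => simp [code] at h₂
      | of_isAtomic ha =>
        cases ha with
        | equal => simp [code, Term.bdEqual] at h₂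
        | rel R ts =>
          refine Iff.trans ?_ (h.rel _ R ts hm)
          simp only [Relations.boundedFormula, code, lhs_pair, args_pair, hmap]
          rfl

/-- The diagram mentions only the symbols and variables listed in `symbols n`, so a table exact on
these may be arbitrary elsewhere. -/
theorem Diagram.of_agreeOn {n : ℕ} {A : List ℕ} {M : Type} {s₁ s₂ : L.Structure M}
    {w₁ w₂ : ℕ → M} (h : @Diagram _ _ _ _ (LHom.id L) n A M s₁ w₁)
    (hs : AgreeOn (symbols n) s₂ s₁) (hw : ∀ s ∈ termNodes n, w₂ s = w₁ s) :
    @Diagram _ _ _ _ (LHom.id L) n A M s₂ w₂ := by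
  obtain ⟨h₁, h₂, h₃⟩ := h
  refine @Diagram.mk _ _ _ _ _ _ _ _ s₂ _ (fun s hs t ht => ?_) (fun k f ts hm => ?_)
    (fun k R ts hm => ?_)
  · rw [hw s hs, hw t ht, h₁ s hs t ht]
  · simp only [hw _ hm, hw _ (mem_termNodes_of_func hm _), h₂ k f ts hm]
    refine (hs.func f ?_ _).symm
    refine List.mem_append_left _ (List.mem_append_right _ (List.mem_map.2
      ⟨_, List.mem_filter.2 ⟨hm, by simp [termCode]⟩, ?_⟩))
    simp [termCode, LHom.id]
  · simp only [hw _ (mem_termNodes_of_rel hm _)]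
    refine (hs.rel R ?_ _).trans (h₃ k R ts hm)
    refine List.mem_append_right _ (List.mem_map.2
      ⟨_, List.mem_filter.2 ⟨hm, by simp [code]⟩, ?_⟩)
    simp [code, LHom.id]

/-- Any model of size `k` can be moved to a standard domain and replaced by a table correct on the
symbols of the axioms and of the formula; there are finitely many such tables and each can be
checked. -/
theorem IsFinitelyAxiomatizable.hasComputableFiniteSpectra {T : L.Theory}
    (h : IsFinitelyAxiomatizable T) : HasComputableFiniteSpectra T := by
  classical
  obtain ⟨B, hB, hT⟩ := h
  obtain ⟨S, hS⟩ := exists_symbols_theory hB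
  obtain ⟨P, hP, hPv⟩ := primrec_eval_theory hB
  have hR : PrimrecRel fun (τ : Table) (y : (ℕ × ℕ) × List ℕ) =>
      P (y.1.2.pred, τ) ∧ TableDiagram y.1.2.pred τ y.1.1 y.2 := by
    have hk : Primrec fun z : Table × (ℕ × ℕ) × List ℕ => (z.2.1.2.pred, z.1) :=
      .pair (Primrec.pred.comp (Primrec.snd.comp (Primrec.fst.comp .snd))) .fst
    exact (hP.comp hk).and (primrecPred_tableDiagram.comp
      (.pair hk (.pair (Primrec.fst.comp (Primrec.fst.comp .snd)) (Primrec.snd.comp .snd))))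
  have hk : Primrec fun y : (ℕ × ℕ) × List ℕ => y.1.2.pred :=
    Primrec.pred.comp (Primrec.snd.comp .fst)
  have htables : Primrec fun y : (ℕ × ℕ) × List ℕ =>
      tables y.1.2.pred (keys y.1.2.pred (S ++ symbols y.1.1)) :=
    primrec_tables.comp hk (primrec_keys.comp hk (Primrec.list_append.comp (.const S)
      (primrec_symbols.comp (Primrec.fst.comp .fst))))
  have htest := (PrimrecRel.exists_mem_list hR).comp htables .id
  obtain ⟨f, hf, H⟩ := computable_exists_guess (n := fun x : ℕ × ℕ => x.1)
    (test := fun x A => decide (∃ τ ∈ tables x.2.pred (keys x.2.pred (S ++ symbols x.1)),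
      P (x.2.pred, τ) ∧ TableDiagram x.2.pred τ x.1 A)) .fst htest.decide.to_comp
  refine ⟨fun n k => f (n, k), hf, fun φ hφ k hk => ?_⟩
  -- Tables live on `Fin (k + 1)`, so the requested positive size enters the algorithm through its
  -- predecessor.
  obtain ⟨k, rfl⟩ := Nat.exists_eq_succ_of_ne_zero hk.ne'
  rw [H]
  simp only [decide_eq_true_eq, Nat.pred_succ]
  constructor
  · rintro ⟨A, -, hA, τ, -, hτ, hd⟩
    let _ := tableStructure L k τ
    obtain ⟨v, hv⟩ := realize_of_diagram hφ hA ((tableDiagram_iff hφ).1 hd)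
    exact ⟨Cardinal.natCast_lt_aleph0.le, Fin (k + 1), _, v, (hT _).2 ((hPv k τ).1 hτ), hv,
      Cardinal.mk_fin _⟩
  · rintro ⟨-, M, _, v, hM, hv, hcard⟩
    obtain ⟨A, hA, hc, w, d⟩ := exists_diagram_of_realize hφ hv
    obtain ⟨e⟩ : Nonempty (M ≃ Fin (k + 1)) := by
      rw [← Cardinal.eq, hcard, Cardinal.mk_fin]
    let s : L.Structure (Fin (k + 1)) := e.inducedStructure
    have hB' : Fin (k + 1) ⊨ B :=
      (hT _).1 (StrongHomClass.theory_model (e.inducedStructureEquiv (L := L)))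
    have d' := d.of_equiv e.inducedStructureEquiv (w' := fun i => e (w i)) fun _ _ => rfl
    obtain ⟨τ, hτ, hag, hw⟩ := exists_table k (S ++ symbols (code φ)) s fun i => e (w i)
    refine ⟨A, hA, hc, τ, hτ, ?_, ?_⟩
    · exact (hPv k τ).2 ((hS _ _ _ (hag.mono (List.subset_append_left _ _))).2 hB')
    · refine (tableDiagram_iff hφ).2 (d'.of_agreeOn
        (hag.mono (List.subset_append_right _ _)) fun i hi => hw i ?_)
      exact List.mem_append_right _ (List.mem_append_left _ (List.mem_append_left _
        (List.mem_map.2 ⟨i, hi, rfl⟩)))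

end

end TheoryCombination

theorem mainTheorem10
    {L₁ L₂ : FirstOrder.Language.{0, 0}}
    [Encodable (Σ n, L₁.Functions n)] [Encodable (Σ n, L₁.Relations n)]
    [Encodable (Σ n, L₂.Functions n)] [Encodable (Σ n, L₂.Relations n)]
    (T₁ : L₁.Theory) (T₂ : L₂.Theory) :
    (TheoryCombination.IsGentle T₁ →
      TheoryCombination.IsDecidable T₂ →
      TheoryCombination.HasComputableFiniteSpectra T₂ →
      TheoryCombination.IsDecidable (TheoryCombination.combine T₁ T₂)) ∧
    (TheoryCombination.IsGentle T₂ ∨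
      TheoryCombination.IsFinitelyAxiomatizable T₂ ∨
      TheoryCombination.HasComputableSpectraAsFiniteSets T₂ →
      TheoryCombination.HasComputableFiniteSpectra T₂) := by
  refine ⟨TheoryCombination.isDecidable_combine, ?_⟩
  rintro (h | h | h)
  exacts [h.hasComputableFiniteSpectra, h.hasComputableFiniteSpectra,
    h.hasComputableFiniteSpectra]
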